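/- Let $(\Omega,\mathscr A,\mathbb P)$ be a probability space and let $(\xi_t,X_\tau)$ be a conjugate process on it: $(\xi_t)_{t=0,1,\dots}$ is a (strictly) stationary sequence of random Borel probability measures on $\mathbb R$, and $(X_\tau)_{\tau\ge 0}$ is a real-valued process such that, with $\Xi:=\sigma(\xi_0,\xi_1,\dots)$, one has $\mathbb P(X_\tau\in B\mid\Xi)=\xi_t(B)$ a.s. for every Borel set $B$, every $t$ and every $\tau\in[t,t+1)$. Assume it is cyclic-independent: conditionally on $\Xi$, the processes $(X_\tau:\tau\in[t,t+1))$, $t=0,1,2,\dots$, form an independent sequence. In each cycle $t$ one observes $X_{it}=X_{\tau_{it}}$, $i=1,\dots,q_t$, where $q_t\ge 1$ and $\tau_{it}\in[t,t+1)$ are deterministic. Let $\mu$ be a finite Borel measure on $\mathbb R$ that is equivalent to Lebesgue measure on some interval containing the support of the barycenter $\mathbb E\xi_0$, and fix an integer $p\ge 1$. Put $F_t(x):=\xi_t(-\infty,x]$ and $C_k(x,y):=\mathrm{Cov}(F_0(x),F_k(y))$. Let $C_0^\mu$ and $R^\mu$ be the integral operators on $L^2(\mu)$ with kernels $C_0(x,y)$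 and $\sum_{k=1}^p\int C_k(x,z)C_k(y,z)\,\mu(dz)$, and let $d:=\operatorname{rank}(C_0^\mu)$. Put $$\widehat F_t(x):=\frac1{q_t}\sum_{i=1}^{q_t}\mathbb I_{[X_{it}\le x]},\qquad \widehat{\mathbb E}F_0:=\frac1n\sum_{t=1}^n\widehat F_t,$$ $$\widehat C_k(x,y):=\frac1{n-p}\sum_{t=1}^{n-p}\bigl(\widehat F_t(x)-\widehat{\mathbb E}F_0(x)\bigr)\bigl(\widehat F_{t+k}(y)-\widehat{\mathbb E}F_0(y)\bigr)\qquad(n>p),$$ let $\widehat R^\mu$ be the integral operator on $L^2(\mu)$ with kernel $\sum_{k=1}^p\int\widehat C_k(x,z)\widehat C_k(y,z)\,\mu(dz)$, and let $\widehat\theta_1\ge\widehat\theta_2\ge\cdots$ be its eigenvalues, repeated according to multiplicity and followed by zeros. Assume that $R^\mu$ and $C_0^\mu$ are range-equivalent, i.e. $\overline{\mathrm{Ran}(R^\mu)}=\overline{\mathrm{Ran}(C_0^\mu)}$, and that the sequence $(\widehat F_t)_{t\ge1}$ of random elements of $L^2(\mu)$ is $\psi$-mixing with coefficients satisfying $\sum_{k\ge1}k\,\Psi(k)^{1/2}<\infty$,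 where $$\Psi(k):=\sup_{J\ge 0}\ \sup\left\{\left|\frac{\mathbb P(A\cap B)}{\mathbb P(A)\mathbb P(B)}-1\right|:\ A\in\sigma(\widehat F_t:1\le t\le J),\ B\in\sigma(\widehat F_t:t\ge J+k),\ \mathbb P(A)\mathbb P(B)>0\right\}.$$ Suppose $d<\infty$, and let $\widehat d:=\#\{j:\widehat\theta_j\ge a_n\}$, where $(a_n)$ is a real sequence with $a_n>0$ for all large $n$, $a_n\to0$ and $n a_n^2\to\infty$. Then $\mathbb P(\widehat d\ne d)\to0$ as $n\to\infty$. -/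

import Mathlib

open MeasureTheory ProbabilityTheory Filter Topology
open scoped NNReal ENNReal

noncomputable section

namespace ConjugateProcesses

/-! ### Integral operators on `L²(μ)` -/

section IntegralOperator

variable {μ : Measure ℝ}

theorem ae_slice_memLp [IsFiniteMeasure μ] {K : ℝ → ℝ → ℝ} (hK : MemLp (Function.uncurry K) 2 (μ.prod μ)) :
    ∀ᵐ x ∂μ, MemLp (K x) 2 μ := by
  have h1 : ∀ᵐ x ∂μ, AEStronglyMeasurable (K x) μ := hK.1.prodMk_left
  have h2 := (memLp_two_iff_integrable_sq hK.1).1 hK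
  have h3 := h2.prod_right_ae
  filter_upwards [h1, h3] with x hx hx'
  exact (memLp_two_iff_integrable_sq hx).2 hx'

theorem sq_integral_mul_le {f g : ℝ → ℝ} (hf : MemLp f 2 μ) (hg : MemLp g 2 μ) :
    (∫ y, f y * g y ∂μ) ^ 2 ≤ (∫ y, f y ^ 2 ∂μ) * ∫ y, g y ^ 2 ∂μ := by
  have hff := (memLp_two_iff_integrable_sq hf.1).1 hf
  have hgg := (memLp_two_iff_integrable_sq hg.1).1 hg
  have hfg : Integrable (fun y => f y * g y) μ := hf.integrable_mul hg
  have key : ∀ t : ℝ, 0 ≤ (∫ y, g y ^ 2 ∂μ) * (t * t) + (2 * ∫ y, f y * g y ∂μ) * t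
      + ∫ y, f y ^ 2 ∂μ := by
    intro t
    have : (∫ y, (t * g y + f y) ^ 2 ∂μ) = (∫ y, g y ^ 2 ∂μ) * (t * t)
        + (2 * ∫ y, f y * g y ∂μ) * t + ∫ y, f y ^ 2 ∂μ := by
      have e : (fun y => (t * g y + f y) ^ 2)
          = fun y => (t * t) * g y ^ 2 + (2 * t) * (f y * g y) + f y ^ 2 := by
        funext y; ring
      have i1 := hgg.const_mul (t * t)
      have i2 := hfg.const_mul (2 * t)
      have i3 : Integrable (fun y => (t * t) * g y ^ 2 + (2 * t) * (f y * g y)) μ := i1.add i2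
      rw [e, integral_add i3 hff, integral_add i1 i2, integral_const_mul, integral_const_mul]
      ring
    rw [← this]
    exact integral_nonneg fun y => sq_nonneg _
  have := discrim_le_zero key
  unfold discrim at this
  nlinarith

variable [IsFiniteMeasure μ]

theorem memLp_integral_kernel {K : ℝ → ℝ → ℝ} (hK : MemLp (Function.uncurry K) 2 (μ.prod μ))
    {f : ℝ → ℝ} (hf : MemLp f 2 μ) : MemLp (fun x => ∫ y, K x y * f y ∂μ) 2 μ := by
  have hm : AEStronglyMeasurable (fun x => ∫ y, K x y * f y ∂μ) μ := by
    have : AEStronglyMeasurable (fun z : ℝ × ℝ => Function.uncurry K z * f z.2) (μ.prod μ) :=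
      hK.1.mul hf.1.comp_snd
    exact this.integral_prod_right'
  rw [memLp_two_iff_integrable_sq hm]
  have h2 := ((memLp_two_iff_integrable_sq hK.1).1 hK).integral_prod_left
  refine (h2.mul_const (∫ y, f y ^ 2 ∂μ)).mono' (hm.pow 2) ?_
  filter_upwards [ae_slice_memLp hK] with x hx
  rw [Real.norm_of_nonneg (sq_nonneg _)]
  exact sq_integral_mul_le hx hf

/-- The integral operator `f ↦ ∫ K(·, y) f(y) μ(dy)` on `L²(μ)` with a kernel `K ∈ L²(μ ⊗ μ)`. -/
def integralOp (K : ℝ → ℝ → ℝ) (hK : MemLp (Function.uncurry K) 2 (μ.prod μ)) :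
    Lp ℝ 2 μ →ₗ[ℝ] Lp ℝ 2 μ where
  toFun f := (memLp_integral_kernel hK (Lp.memLp f)).toLp (fun x => ∫ y, K x y * f y ∂μ)
  map_add' f g := by
    rw [← MemLp.toLp_add]
    refine MemLp.toLp_congr _ _ ?_
    filter_upwards [ae_slice_memLp hK] with x hx
    have e : (∫ y, K x y * (f + g : Lp ℝ 2 μ) y ∂μ) = ∫ y, (K x y * f y + K x y * g y) ∂μ := by
      refine integral_congr_ae ?_
      filter_upwards [Lp.coeFn_add f g] with y hy
      rw [hy, Pi.add_apply, mul_add]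
    rw [e]
    exact integral_add (hx.integrable_mul (Lp.memLp f)) (hx.integrable_mul (Lp.memLp g))
  map_smul' c f := by
    rw [RingHom.id_apply, ← MemLp.toLp_const_smul]
    refine MemLp.toLp_congr _ _ (Eventually.of_forall fun x => ?_)
    have e : (∫ y, K x y * (c • f : Lp ℝ 2 μ) y ∂μ) = ∫ y, c * (K x y * f y) ∂μ := by
      refine integral_congr_ae ?_
      filter_upwards [Lp.coeFn_smul c f] with y hy
      rw [hy, Pi.smul_apply, smul_eq_mul]
      ring
    simp only [Pi.smul_apply, smul_eq_mul]
    rw [e, integral_const_mul]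

theorem memLp_of_bounded {K : ℝ → ℝ → ℝ} (hm : Measurable (Function.uncurry K)) {M : ℝ}
    (hb : ∀ x y, |K x y| ≤ M) : MemLp (Function.uncurry K) 2 (μ.prod μ) :=
  MemLp.of_bound hm.aestronglyMeasurable M (Eventually.of_forall fun z => hb z.1 z.2)

variable (μ) in
/-- `∑_{k=1}^p ∫ C_k(x, z) C_k(y, z) μ(dz)`. -/
def sumSqKernel (p : ℕ) (C : ℕ → ℝ → ℝ → ℝ) (x y : ℝ) : ℝ :=
  ∑ k ∈ Finset.Icc 1 p, ∫ z, C k x z * C k y z ∂μ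

theorem memLp_sumSqKernel (p : ℕ) {C : ℕ → ℝ → ℝ → ℝ}
    (hm : ∀ k, Measurable (Function.uncurry (C k))) {M : ℝ} (hb : ∀ k x y, |C k x y| ≤ M) :
    MemLp (Function.uncurry (sumSqKernel μ p C)) 2 (μ.prod μ) := by
  have hh : ∀ k, Measurable fun w : (ℝ × ℝ) × ℝ => C k w.1.1 w.2 * C k w.1.2 w.2 := fun k =>
    ((hm k).comp (measurable_fst.fst.prodMk measurable_snd)).mul
      ((hm k).comp (measurable_fst.snd.prodMk measurable_snd))
  have hmeas : Measurable (Function.uncurry (sumSqKernel μ p C)) := by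
    have hk : ∀ k, Measurable fun w : ℝ × ℝ => ∫ z, C k w.1 z * C k w.2 z ∂μ := by
      intro k
      exact (hh k).stronglyMeasurable.integral_prod_right' (ν := μ) |>.measurable
    change Measurable fun w : ℝ × ℝ => ∑ k ∈ Finset.Icc 1 p, ∫ z, C k w.1 z * C k w.2 z ∂μ
    exact Finset.measurable_fun_sum _ fun k _ => hk k
  refine memLp_of_bounded hmeas (M := ∑ _k ∈ Finset.Icc 1 p, M * M * μ.real Set.univ)
    fun x y => (Finset.abs_sum_le_sum_abs _ _).trans (Finset.sum_le_sum fun k _ => ?_)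
  rw [← Real.norm_eq_abs]
  refine norm_integral_le_of_norm_le_const (Eventually.of_forall fun z => ?_)
  rw [Real.norm_eq_abs, abs_mul]
  exact mul_le_mul (hb k x z) (hb k y z) (abs_nonneg _) ((abs_nonneg _).trans (hb k x z))

end IntegralOperator

/-! ### Eigenvalues and ranges of operators -/

section Operators

variable {H : Type*} [NormedAddCommGroup H] [InnerProductSpace ℝ H]

/-- The non-increasing sequence of eigenvalues, repeated according to multiplicity, of a positive
compact self-adjoint operator `T`, indexed from `0` and padded with zeros if `T` has finite rank:
the `j`-th one is the largest `c > 0` for which there are `j + 1` orthonormal eigenvectors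
with eigenvalues at least `c`, and it is `0` if there is no such `c`. -/
def eigenvalueSeq (T : H →ₗ[ℝ] H) (j : ℕ) : ℝ :=
  sSup (insert 0 {c : ℝ | 0 < c ∧ ∃ v : Fin (j + 1) → H, Orthonormal ℝ v ∧
    ∀ i, ∃ c' : ℝ, c ≤ c' ∧ T (v i) = c' • v i})

/-- Two operators are range-equivalent if the closures of their ranges coincide. -/
def RangeEquivalent (T S : H →ₗ[ℝ] H) : Prop :=
  closure (LinearMap.range T : Set H) = closure (LinearMap.range S : Set H)

end Operators

/-! ### `ψ`-mixing -/

section Mixing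

variable {Ω : Type*} [MeasurableSpace Ω]

/-- The coefficient of dependence `ψ(𝓐, 𝓑) = sup |P(A ∩ B) / (P(A) P(B)) - 1|`, where the supremum
is over `A ∈ 𝓐`, `B ∈ 𝓑` with `P(A) > 0`, `P(B) > 0`. -/
def psiDependence (P : Measure Ω) (mA mB : MeasurableSpace Ω) : ℝ≥0∞ :=
  ⨆ (A : Set Ω) (_ : MeasurableSet[mA] A) (_ : 0 < P.real A)
    (B : Set Ω) (_ : MeasurableSet[mB] B) (_ : 0 < P.real B),
    ENNReal.ofReal |P.real (A ∩ B) / (P.real A * P.real B) - 1|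

/-- The `σ`-field generated by the random elements `Y t`, `t ∈ s`. -/
@[reducible] def sigmaOf {E : Type*} [TopologicalSpace E] (Y : ℕ → Ω → E) (s : Set ℕ) : MeasurableSpace Ω :=
  ⨆ t ∈ s, MeasurableSpace.comap (Y t) (borel E)

/-- The `k`-th `ψ`-mixing coefficient of the sequence `Y 1, Y 2, …`. -/
def psiMixingCoeff {E : Type*} [TopologicalSpace E] (P : Measure Ω) (Y : ℕ → Ω → E) (k : ℕ) :
    ℝ≥0∞ :=
  ⨆ J : ℕ, psiDependence P (sigmaOf Y (Set.Icc 1 J)) (sigmaOf Y (Set.Ici (J + k)))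

end Mixing

/-! ### Conjugate processes -/

/-- A conjugate process `(ξ_t, X_τ)` on `(Ω, P)` with a stationary latent sequence `(ξ_t)`.
`ProbabilityMeasure ℝ` carries the `σ`-field generated by the evaluations `ν ↦ ν(B)`, which is
the Borel `σ`-field of the weak topology. -/
structure ConjugateProcess {Ω : Type*} [mΩ : MeasurableSpace Ω] (P : Measure Ω) where
  /-- the latent distribution process -/
  ξ : ℕ → Ω → ProbabilityMeasure ℝ
  /-- the observable process -/
  X : ℝ≥0 → Ω → ℝ
  measurable_ξ : ∀ t, Measurable (ξ t)
  measurable_X : ∀ τ, Measurable (X τ)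
  stationary : ∀ h : ℕ, IdentDistrib (fun ω t => ξ (t + h) ω) (fun ω t => ξ t ω) P P
  compatible : ∀ (t : ℕ) (τ : ℝ≥0), (t : ℝ≥0) ≤ τ → τ < (t : ℝ≥0) + 1 → ∀ B : Set ℝ, MeasurableSet B →
    P⟦X τ ⁻¹' B | ⨆ s, MeasurableSpace.comap (ξ s) inferInstance⟧
      =ᵐ[P] fun ω => (ξ t ω : Measure ℝ).real B

/-- A sampling scheme: in each cycle `t` the observable process is sampled at `q t ≥ 1` instants
of `[t, t + 1)`. -/
structure SamplingScheme where
  q : ℕ → ℕ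
  q_pos : ∀ t, 0 < q t
  time : (t : ℕ) → Fin (q t) → ℝ≥0
  le_time : ∀ (t : ℕ) (i : Fin (q t)), (t : ℝ≥0) ≤ time t i
  time_lt : ∀ (t : ℕ) (i : Fin (q t)), time t i < (t : ℝ≥0) + 1

namespace ConjugateProcess

variable {Ω : Type*} [mΩ : MeasurableSpace Ω] {P : Measure Ω}

/-- The `σ`-field `Ξ = σ(ξ_0, ξ_1, …)`. -/
@[reducible] def Xi (Z : ConjugateProcess P) : MeasurableSpace Ω :=
  ⨆ s, MeasurableSpace.comap (Z.ξ s) inferInstance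

/-- The `σ`-field generated by the observable process during cycle `t`. -/
@[reducible] def cycleSigma (Z : ConjugateProcess P) (t : ℕ) : MeasurableSpace Ω :=
  ⨆ τ ∈ Set.Ico (t : ℝ≥0) (t + 1), MeasurableSpace.comap (Z.X τ) inferInstance

/-- Conditionally on `Ξ`, the processes `(X_τ : τ ∈ [t, t + 1))`, `t = 0, 1, …`, form an
independent sequence. -/
def CyclicIndependent (Z : ConjugateProcess P) : Prop :=
  ∀ (s : Finset ℕ) (A : ℕ → Set Ω), (∀ t ∈ s, MeasurableSet[Z.cycleSigma t] (A t)) →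
    P⟦⋂ t ∈ s, A t | Z.Xi⟧ =ᵐ[P] ∏ t ∈ s, P⟦A t | Z.Xi⟧

/-- The barycenter `𝔼 ξ_0`. -/
def barycenter (Z : ConjugateProcess P) : Measure ℝ :=
  P.bind fun ω => (Z.ξ 0 ω : Measure ℝ)

/-- `μ` is equivalent to Lebesgue measure on some interval that contains the support of `𝔼 ξ_0`. -/
def IsDiffraction (Z : ConjugateProcess P) (μ : Measure ℝ) : Prop :=
  ∃ I : Set ℝ, I.OrdConnected ∧ Z.barycenter.support ⊆ I ∧
    μ ≪ volume.restrict I ∧ volume.restrict I ≪ μ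

/-- `F_t(x) = ξ_t(-∞, x]`. -/
def F (Z : ConjugateProcess P) (t : ℕ) (x : ℝ) (ω : Ω) : ℝ :=
  (Z.ξ t ω : Measure ℝ).real (Set.Iic x)

/-- `C_k(x, y) = Cov(F_0(x), F_k(y))`. -/
def C (Z : ConjugateProcess P) (k : ℕ) (x y : ℝ) : ℝ :=
  cov[Z.F 0 x, Z.F k y; P]

theorem measurable_F (Z : ConjugateProcess P) (t : ℕ) :
    Measurable fun z : ℝ × Ω => Z.F t z.1 z.2 := by
  let κ : Kernel (ℝ × Ω) ℝ :=
    ⟨fun z => (Z.ξ t z.2 : Measure ℝ),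
      measurable_subtype_coe.comp ((Z.measurable_ξ t).comp measurable_snd)⟩
  have : IsMarkovKernel κ := ⟨fun z => (Z.ξ t z.2).2⟩
  have hs : MeasurableSet {w : (ℝ × Ω) × ℝ | w.2 ≤ w.1.1} :=
    measurableSet_le measurable_snd measurable_fst.fst
  exact (Kernel.measurable_kernel_prodMk_left (κ := κ) hs).ennreal_toReal

theorem F_mem (Z : ConjugateProcess P) (t : ℕ) (x : ℝ) (ω : Ω) :
    0 ≤ Z.F t x ω ∧ Z.F t x ω ≤ 1 :=
  ⟨measureReal_nonneg, measureReal_le_one⟩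

variable [IsProbabilityMeasure P]

theorem measurable_C (Z : ConjugateProcess P) (k : ℕ) : Measurable (Function.uncurry (Z.C k)) := by
  have hmean : ∀ t, Measurable fun x => ∫ ω, Z.F t x ω ∂P := fun t =>
    ((Z.measurable_F t).stronglyMeasurable.integral_prod_right' (ν := P)).measurable
  have h : Measurable fun w : (ℝ × ℝ) × Ω =>
      (Z.F 0 w.1.1 w.2 - ∫ ω, Z.F 0 w.1.1 ω ∂P) * (Z.F k w.1.2 w.2 - ∫ ω, Z.F k w.1.2 ω ∂P) :=
    (((Z.measurable_F 0).comp (measurable_fst.fst.prodMk measurable_snd)).sub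
      ((hmean 0).comp measurable_fst.fst)).mul
    (((Z.measurable_F k).comp (measurable_fst.snd.prodMk measurable_snd)).sub
      ((hmean k).comp measurable_fst.snd))
  exact (h.stronglyMeasurable.integral_prod_right' (ν := P)).measurable

theorem abs_C_le (Z : ConjugateProcess P) (k : ℕ) (x y : ℝ) : |Z.C k x y| ≤ 1 := by
  have hmean : ∀ t x, 0 ≤ (∫ ω, Z.F t x ω ∂P) ∧ (∫ ω, Z.F t x ω ∂P) ≤ 1 := fun t x => by
    refine ⟨integral_nonneg fun ω => (Z.F_mem t x ω).1, ?_⟩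
    have h := norm_integral_le_of_norm_le_const (μ := P) (f := fun ω => Z.F t x ω) (C := 1)
      (Eventually.of_forall fun ω => by
        rw [Real.norm_of_nonneg (Z.F_mem t x ω).1]; exact (Z.F_mem t x ω).2)
    rw [probReal_univ, mul_one] at h
    exact (le_abs_self _).trans h
  have h1 : ∀ t x ω, |Z.F t x ω - ∫ ω, Z.F t x ω ∂P| ≤ 1 := fun t x ω => by
    rw [abs_le]
    constructor <;> linarith [(hmean t x).1, (hmean t x).2, (Z.F_mem t x ω).1, (Z.F_mem t x ω).2]
  have h := norm_integral_le_of_norm_le_const (μ := P) (C := 1)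
    (f := fun ω => (Z.F 0 x ω - ∫ ω, Z.F 0 x ω ∂P) * (Z.F k y ω - ∫ ω, Z.F k y ω ∂P))
    (Eventually.of_forall fun ω => by
      rw [Real.norm_eq_abs, abs_mul]
      exact mul_le_one₀ (h1 0 x ω) (abs_nonneg _) (h1 k y ω))
  rw [probReal_univ, mul_one] at h
  exact h

/-- The covariance operator `C_0^μ` on `L²(μ)`, with kernel `C_0`. -/
def covOp (Z : ConjugateProcess P) (μ : Measure ℝ) [IsFiniteMeasure μ] :
    Lp ℝ 2 μ →ₗ[ℝ] Lp ℝ 2 μ :=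
  integralOp (Z.C 0) (memLp_of_bounded (Z.measurable_C 0) (Z.abs_C_le 0))

/-- The operator `R^μ` on `L²(μ)`, with kernel `∑_{k=1}^p ∫ C_k(x, z) C_k(y, z) μ(dz)`. -/
def ROp (Z : ConjugateProcess P) (μ : Measure ℝ) [IsFiniteMeasure μ] (p : ℕ) :
    Lp ℝ 2 μ →ₗ[ℝ] Lp ℝ 2 μ :=
  integralOp (sumSqKernel μ p Z.C) (memLp_sumSqKernel p Z.measurable_C Z.abs_C_le)

end ConjugateProcess

/-! ### Estimators -/

namespace ConjugateProcess

variable {Ω : Type*} [mΩ : MeasurableSpace Ω] {P : Measure Ω}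

/-- The empirical distribution function `F̂_t` of the observations in cycle `t`. -/
def Fhat (Z : ConjugateProcess P) (S : SamplingScheme) (t : ℕ) (ω : Ω) (x : ℝ) : ℝ :=
  (1 / (S.q t : ℝ)) * ∑ i : Fin (S.q t), Set.indicator (Set.Iic x) 1 (Z.X (S.time t i) ω)

/-- The estimator `n⁻¹ ∑_{t=1}^n F̂_t(x)` of `𝔼 F_0(x)`. -/
def meanHat (Z : ConjugateProcess P) (S : SamplingScheme) (n : ℕ) (ω : Ω) (x : ℝ) : ℝ :=
  (1 / (n : ℝ)) * ∑ t ∈ Finset.Icc 1 n, Z.Fhat S t ω x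

/-- The estimator `Ĉ_k` of `C_k` based on the cycles `1, …, n`; it is used for `n > p` only. -/
def Chat (Z : ConjugateProcess P) (S : SamplingScheme) (p n : ℕ) (ω : Ω) (k : ℕ) (x y : ℝ) : ℝ :=
  (1 / ((n : ℝ) - (p : ℝ))) * ∑ t ∈ Finset.Icc 1 (n - p),
    (Z.Fhat S t ω x - Z.meanHat S n ω x) * (Z.Fhat S (t + k) ω y - Z.meanHat S n ω y)

theorem measurable_Fhat (Z : ConjugateProcess P) (S : SamplingScheme) (t : ℕ) (ω : Ω) :
    Measurable (Z.Fhat S t ω) := by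
  refine (Finset.measurable_sum _ fun i _ => ?_).const_mul _
  have : (fun x => Set.indicator (Set.Iic x) (1 : ℝ → ℝ) (Z.X (S.time t i) ω))
      = Set.indicator (Set.Ici (Z.X (S.time t i) ω)) 1 := by
    funext x
    simp [Set.indicator_apply]
  rw [this]
  exact measurable_one.indicator measurableSet_Ici

theorem Fhat_mem (Z : ConjugateProcess P) (S : SamplingScheme) (t : ℕ) (ω : Ω) (x : ℝ) :
    0 ≤ Z.Fhat S t ω x ∧ Z.Fhat S t ω x ≤ 1 := by
  have hq : (0 : ℝ) < S.q t := by exact_mod_cast S.q_pos t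
  have h0 : ∀ i, 0 ≤ Set.indicator (Set.Iic x) (1 : ℝ → ℝ) (Z.X (S.time t i) ω) := fun i =>
    Set.indicator_nonneg (fun _ _ => zero_le_one) _
  have h1 : ∀ i, Set.indicator (Set.Iic x) (1 : ℝ → ℝ) (Z.X (S.time t i) ω) ≤ 1 := fun i =>
    Set.indicator_apply_le' (fun _ => le_rfl) fun _ => zero_le_one
  refine ⟨mul_nonneg (by positivity) (Finset.sum_nonneg fun i _ => h0 i), ?_⟩
  have h2 := Finset.sum_le_sum fun i (_ : i ∈ (Finset.univ : Finset (Fin (S.q t)))) => h1 i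
  simp only [Finset.sum_const, Finset.card_univ, Fintype.card_fin, nsmul_eq_mul, mul_one] at h2
  unfold Fhat
  rw [one_div, inv_mul_le_iff₀ hq, mul_one]
  exact h2

theorem measurable_meanHat (Z : ConjugateProcess P) (S : SamplingScheme) (n : ℕ) (ω : Ω) :
    Measurable (Z.meanHat S n ω) :=
  (Finset.measurable_sum _ fun t _ => Z.measurable_Fhat S t ω).const_mul _

theorem meanHat_mem (Z : ConjugateProcess P) (S : SamplingScheme) (n : ℕ) (ω : Ω) (x : ℝ) :
    0 ≤ Z.meanHat S n ω x ∧ Z.meanHat S n ω x ≤ 1 := by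
  refine ⟨mul_nonneg (by positivity) (Finset.sum_nonneg fun t _ => (Z.Fhat_mem S t ω x).1), ?_⟩
  have h2 := Finset.sum_le_sum fun t (_ : t ∈ Finset.Icc 1 n) => (Z.Fhat_mem S t ω x).2
  simp only [Finset.sum_const, Nat.card_Icc, nsmul_eq_mul, mul_one, Nat.add_sub_cancel] at h2
  unfold meanHat
  rw [one_div]
  exact inv_mul_le_one_of_le₀ h2 (Nat.cast_nonneg n)

theorem measurable_Chat (Z : ConjugateProcess P) (S : SamplingScheme) (p n : ℕ) (ω : Ω) (k : ℕ) :
    Measurable (Function.uncurry (Z.Chat S p n ω k)) := by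
  refine (Finset.measurable_sum _ fun t _ => ?_).const_mul _
  exact (((Z.measurable_Fhat S t ω).comp measurable_fst).sub
      ((Z.measurable_meanHat S n ω).comp measurable_fst)).mul
    (((Z.measurable_Fhat S (t + k) ω).comp measurable_snd).sub
      ((Z.measurable_meanHat S n ω).comp measurable_snd))

theorem abs_Chat_le (Z : ConjugateProcess P) (S : SamplingScheme) (p n : ℕ) (ω : Ω) (k : ℕ)
    (x y : ℝ) : |Z.Chat S p n ω k x y| ≤ 1 := by
  have h1 : ∀ t x, |Z.Fhat S t ω x - Z.meanHat S n ω x| ≤ 1 := fun t x => by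
    rw [abs_le]
    constructor <;> linarith [(Z.Fhat_mem S t ω x).1, (Z.Fhat_mem S t ω x).2,
      (Z.meanHat_mem S n ω x).1, (Z.meanHat_mem S n ω x).2]
  rcases le_or_gt n p with hnp | hnp
  · simp [Chat, Nat.sub_eq_zero_of_le hnp]
  have hpos : (0 : ℝ) < (n : ℝ) - p := by
    have : (p : ℝ) < n := by exact_mod_cast hnp
    linarith
  have h2 : |∑ t ∈ Finset.Icc 1 (n - p), (Z.Fhat S t ω x - Z.meanHat S n ω x) *
      (Z.Fhat S (t + k) ω y - Z.meanHat S n ω y)| ≤ (n : ℝ) - p := by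
    refine (Finset.abs_sum_le_sum_abs _ _).trans ?_
    refine (Finset.sum_le_sum (g := fun _ => (1 : ℝ)) fun t _ => ?_).trans ?_
    · rw [abs_mul]
      exact mul_le_one₀ (h1 t x) (abs_nonneg _) (h1 (t + k) y)
    · simp [Nat.cast_sub hnp.le]
  unfold Chat
  rw [abs_mul, abs_of_pos (one_div_pos.2 hpos), one_div, inv_mul_le_iff₀ hpos, mul_one]
  exact h2

theorem memLp_Fhat (Z : ConjugateProcess P) (S : SamplingScheme) (μ : Measure ℝ)
    [IsFiniteMeasure μ] (t : ℕ) (ω : Ω) : MemLp (Z.Fhat S t ω) 2 μ :=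
  MemLp.of_bound (Z.measurable_Fhat S t ω).aestronglyMeasurable 1 (Eventually.of_forall fun x => by
    rw [Real.norm_of_nonneg (Z.Fhat_mem S t ω x).1]; exact (Z.Fhat_mem S t ω x).2)

/-- `F̂_t` as a random element of `L²(μ)`. -/
def FhatLp (Z : ConjugateProcess P) (S : SamplingScheme) (μ : Measure ℝ) [IsFiniteMeasure μ]
    (t : ℕ) (ω : Ω) : Lp ℝ 2 μ :=
  (Z.memLp_Fhat S μ t ω).toLp (Z.Fhat S t ω)

/-- The estimator `R̂^μ` of `R^μ`, with kernel `∑_{k=1}^p ∫ Ĉ_k(x, z) Ĉ_k(y, z) μ(dz)`. -/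
def RhatOp (Z : ConjugateProcess P) (S : SamplingScheme) (μ : Measure ℝ) [IsFiniteMeasure μ]
    (p n : ℕ) (ω : Ω) : Lp ℝ 2 μ →ₗ[ℝ] Lp ℝ 2 μ :=
  integralOp (sumSqKernel μ p (Z.Chat S p n ω))
    (memLp_sumSqKernel p (Z.measurable_Chat S p n ω) (Z.abs_Chat_le S p n ω))

/-- The estimated eigenvalues `θ̂_0 ≥ θ̂_1 ≥ …` of `R̂^μ`. -/
def thetaHat (Z : ConjugateProcess P) (S : SamplingScheme) (μ : Measure ℝ) [IsFiniteMeasure μ]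
    (p n : ℕ) (ω : Ω) (j : ℕ) : ℝ :=
  eigenvalueSeq (Z.RhatOp S μ p n ω) j

/-- The estimated dimension `d̂ = #{j : θ̂_j ≥ a}`. -/
def dHat (Z : ConjugateProcess P) (S : SamplingScheme) (μ : Measure ℝ) [IsFiniteMeasure μ]
    (p n : ℕ) (a : ℝ) (ω : Ω) : ℕ∞ :=
  {j : ℕ | a ≤ Z.thetaHat S μ p n ω j}.encard

end ConjugateProcess

end ConjugateProcesses

end

open ConjugateProcesses

/-! The estimated dimension is correct as soon as the operator error is small against the threshold
and the threshold is small against the spectrum of `R^μ`. The first is an event of probability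
tending to one, the second holds for all large `n`.

Deterministic half. Range equivalence and `d < ∞` make the two ranges equal, so `R^μ` is symmetric
and positive of rank `d`, and its form is at least `θ‖x‖²` on its range for some `θ > 0`. Suppose
the form of `R̂^μ - R^μ` is at most `δ‖x‖²` in absolute value. Two dimension counts in the style of
Courant–Fischer bound the eigenvalues of `R̂^μ`: those of index at least `d` are at most `δ`
(`eigenvalueSeq_le`), and the first `d` are at least `a` whenever `a + δ < θ`
(`le_eigenvalueSeq_of_form_lower_bound`). Hence `δ < a < θ/2` forces `d̂ = d`
(`exists_forall_dHat_eq`). Here `δ²` is a constant times `covError`, because the Hilbert–Schmidt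
norm dominates the operator norm and the kernels are bounded (`integral_sumSqKernel_sub_sq_le`).

Probabilistic half. Cyclic independence makes `F̂_t(x) F̂_{t+k}(y)` unbiased for `𝔼 F_0(x) F_k(y)`
when `k ≥ 1`, so the error of `Ĉ_k(x, y)` is governed by averages of centred bounded variables.
Their covariances are bounded by the `ψ`-coefficients, which are summable, so the mean squared error
is `O(1/n)` (`integral_Chat_sub_C_sq_le`). Mixing is assumed for `F̂_t` as an element of `L²(μ)`,
while these estimates are pointwise; right-continuity of `F̂_t` recovers its values from its class
at `μ`-almost every point (`measurable_comap_FhatLp`, `ae_forall_pos_measure_Icc`). Integrating over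
`μ ⊗ μ` gives `𝔼 covError = O(1/n)`, and Markov's inequality bounds the failure probability by a
constant over `n a_n²`. -/

namespace ConjugateProcesses

/-! ### Eigenvalue perturbation for symmetric operators of finite rank. -/

section Spectral

variable {H : Type*} [NormedAddCommGroup H] [InnerProductSpace ℝ H]

open scoped InnerProductSpace

/-- A symmetric operator with finite-dimensional range is diagonalizable on its range. -/
theorem exists_eigenbasis_range {T : H →ₗ[ℝ] H} (hT : T.IsSymmetric)
    [FiniteDimensional ℝ (LinearMap.range T)] :
    ∃ (b : OrthonormalBasis (Fin (Module.finrank ℝ (LinearMap.range T))) ℝ (LinearMap.range T))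
      (l : Fin (Module.finrank ℝ (LinearMap.range T)) → ℝ),
      (∀ i, T (b i : H) = l i • (b i : H)) ∧
      ∀ x : LinearMap.range T, ⟪T x, (x : H)⟫_ℝ = ∑ i, l i * ⟪(b i : H), (x : H)⟫_ℝ ^ 2 := by
  have hinv : ∀ x ∈ LinearMap.range T, T x ∈ LinearMap.range T := fun x _ => ⟨x, rfl⟩
  have hs := hT.restrict_invariant hinv
  refine ⟨hs.eigenvectorBasis rfl, hs.eigenvalues rfl, fun i => ?_, fun x => ?_⟩
  · exact congrArg Subtype.val (hs.apply_eigenvectorBasis rfl i)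
  · have h := (hs.eigenvectorBasis rfl).sum_inner_mul_inner (T.restrict hinv x) x
    have e : ⟪T x, (x : H)⟫_ℝ = ⟪T.restrict hinv x, x⟫_ℝ := by simp
    rw [e, ← h]
    refine Finset.sum_congr rfl fun i _ => ?_
    have h3 : ⟪T.restrict hinv x, hs.eigenvectorBasis rfl i⟫_ℝ
        = hs.eigenvalues rfl i * ⟪hs.eigenvectorBasis rfl i, x⟫_ℝ := by
      rw [hs, hs.apply_eigenvectorBasis, inner_smul_right, real_inner_comm]
      simp
    rw [h3, Submodule.coe_inner]
    ring

/-- For a symmetric operator, range and kernel are orthogonal. -/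
theorem eq_zero_of_mem_range_of_apply_eq_zero {T : H →ₗ[ℝ] H} (hT : T.IsSymmetric) {x : H}
    (hx : x ∈ LinearMap.range T) (h : T x = 0) : x = 0 := by
  obtain ⟨y, rfl⟩ := hx
  rw [← inner_self_eq_zero (𝕜 := ℝ), hT, h, inner_zero_right]

/-- On the range there are finitely many eigenvalues, nonnegative by positivity and nonzero because
the kernel meets the range trivially; `θ` is the least of them, or 1 if the range is trivial. -/
theorem exists_pos_le_inner_of_mem_range {R : H →ₗ[ℝ] H} (hR : R.IsSymmetric)
    (hpos : ∀ x, 0 ≤ ⟪R x, x⟫_ℝ) [FiniteDimensional ℝ (LinearMap.range R)] :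
    ∃ θ : ℝ, 0 < θ ∧ ∀ x ∈ LinearMap.range R, θ * ‖x‖ ^ 2 ≤ ⟪R x, x⟫_ℝ := by
  obtain ⟨b, l, hb, hl⟩ := exists_eigenbasis_range hR
  have hlpos : ∀ i, 0 < l i := by
    intro i
    have h1 := hpos (b i : H)
    have hn : ‖(b i : H)‖ = 1 := b.orthonormal.1 i
    rw [hb, real_inner_smul_left, real_inner_self_eq_norm_sq, hn] at h1
    have h0 : l i ≠ 0 := fun h0 => by
      have := eq_zero_of_mem_range_of_apply_eq_zero hR (b i).2 (by rw [hb, h0, zero_smul])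
      rw [this, norm_zero] at hn
      exact zero_ne_one hn
    exact lt_of_le_of_ne (by linarith) h0.symm
  obtain ⟨θ, hθ, hθl⟩ : ∃ θ : ℝ, 0 < θ ∧ ∀ i, θ ≤ l i := by
    rcases isEmpty_or_nonempty (Fin (Module.finrank ℝ (LinearMap.range R))) with h | h
    · exact ⟨1, one_pos, fun i => h.elim i⟩
    · obtain ⟨i, hi⟩ := Finite.exists_min l
      exact ⟨l i, hlpos i, hi⟩
  refine ⟨θ, hθ, fun x hx => ?_⟩
  have h := hl ⟨x, hx⟩
  have h2 := b.sum_sq_inner_right ⟨x, hx⟩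
  simp only [Submodule.coe_inner, Submodule.coe_norm] at h h2
  rw [h, ← h2, Finset.mul_sum]
  exact Finset.sum_le_sum fun i _ => mul_le_mul_of_nonneg_right (hθl i) (sq_nonneg _)

/-- More than `rank R` orthonormal vectors have a nontrivial combination `x` killed by `R`. There
the form of `T` is at least `c‖x‖²`, yet differs from zero by at most `δ‖x‖²`. -/
theorem le_of_orthonormal_eigenvectors {T R : H →ₗ[ℝ] H} {δ : ℝ}
    (hδ : ∀ x, |⟪T x - R x, x⟫_ℝ| ≤ δ * ‖x‖ ^ 2) [FiniteDimensional ℝ (LinearMap.range R)]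
    {m : ℕ} (hm : Module.finrank ℝ (LinearMap.range R) < m) {v : Fin m → H}
    (hv : Orthonormal ℝ v) {c : ℝ} (hc : ∀ i, ∃ c' : ℝ, c ≤ c' ∧ T (v i) = c' • v i) : c ≤ δ := by
  choose c' hcc' hT using hc
  have hker : LinearMap.ker (R.rangeRestrict ∘ₗ Fintype.linearCombination ℝ v) ≠ ⊥ :=
    LinearMap.ker_ne_bot_of_finrank_lt (by simpa using hm)
  obtain ⟨α, hα, hα0⟩ := Submodule.exists_mem_ne_zero_of_ne_bot hker
  set x : H := Fintype.linearCombination ℝ v α with hx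
  have hxs : x = ∑ i, α i • v i := by rw [hx, Fintype.linearCombination_apply]
  have hRx : R x = 0 := by
    have := congrArg Subtype.val (LinearMap.mem_ker.1 hα)
    simpa using this
  have hnorm : ‖x‖ ^ 2 = ∑ i, α i ^ 2 := by
    rw [← real_inner_self_eq_norm_sq, hxs, hv.inner_sum]
    simp [sq]
  have hTx : ⟪T x, x⟫_ℝ = ∑ i, c' i * α i ^ 2 := by
    have : T x = ∑ i, (α i * c' i) • v i := by
      rw [hxs, map_sum]
      exact Finset.sum_congr rfl fun i _ => by rw [map_smul, hT, smul_smul]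
    rw [this, hxs, hv.inner_sum]
    refine Finset.sum_congr rfl fun i _ => ?_
    simp only [conj_trivial]
    ring
  have hpos : 0 < ‖x‖ ^ 2 := by
    rw [hnorm]
    obtain ⟨i, hi⟩ := Function.ne_iff.1 hα0
    exact Finset.sum_pos' (fun i _ => sq_nonneg _) ⟨i, Finset.mem_univ _, by
      have : α i ≠ 0 := hi
      positivity⟩
  have h1 : c * ‖x‖ ^ 2 ≤ ⟪T x, x⟫_ℝ := by
    rw [hTx, hnorm, Finset.mul_sum]
    exact Finset.sum_le_sum fun i _ => mul_le_mul_of_nonneg_right (hcc' i) (sq_nonneg _)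
  have h2 := (le_abs_self _).trans (hδ x)
  rw [hRx, sub_zero] at h2
  exact le_of_mul_le_mul_right (h1.trans h2) hpos

theorem eigenvalueSeq_le {T R : H →ₗ[ℝ] H} {δ : ℝ} (hδ0 : 0 ≤ δ)
    (hδ : ∀ x, |⟪T x - R x, x⟫_ℝ| ≤ δ * ‖x‖ ^ 2) [FiniteDimensional ℝ (LinearMap.range R)]
    {j : ℕ} (hj : Module.finrank ℝ (LinearMap.range R) ≤ j) : eigenvalueSeq T j ≤ δ := by
  refine csSup_le (Set.insert_nonempty _ _) ?_
  rintro c (rfl | ⟨-, v, hv, hc⟩)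
  · exact hδ0
  · exact le_of_orthonormal_eigenvectors hδ (Nat.lt_succ_of_le hj) hv hc

/-- The form bound `hM` makes the set under `sSup` bounded above; for an unbounded set the real
`sSup` would be 0. -/
theorem le_eigenvalueSeq {T : H →ₗ[ℝ] H} {j : ℕ} {M : ℝ} (hM0 : 0 ≤ M)
    (hM : ∀ x, |⟪T x, x⟫_ℝ| ≤ M * ‖x‖ ^ 2) {a : ℝ} (ha : 0 < a) {v : Fin (j + 1) → H}
    (hv : Orthonormal ℝ v) (hc : ∀ i, ∃ c' : ℝ, a ≤ c' ∧ T (v i) = c' • v i) :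
    a ≤ eigenvalueSeq T j := by
  refine le_csSup ⟨M, ?_⟩ (Or.inr ⟨ha, v, hv, hc⟩)
  rintro c (rfl | ⟨-, w, hw, hc⟩)
  · exact hM0
  · obtain ⟨c', hcc', h⟩ := hc 0
    have := (le_abs_self _).trans (hM (w 0))
    rw [h, real_inner_smul_left, real_inner_self_eq_norm_sq, hw.1 0] at this
    linarith

/-- If `T` had at most `j` eigenvalues that are at least `a`, some nonzero `x` in `U` would be
orthogonal to all their eigenvectors. Then `⟪T x, x⟫ ≤ a‖x‖²`, against `⟪T x, x⟫ ≥ (θ - δ)‖x‖²`. -/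
theorem le_eigenvalueSeq_of_form_lower_bound {T R : H →ₗ[ℝ] H} (hT : T.IsSymmetric)
    [FiniteDimensional ℝ (LinearMap.range T)] {M : ℝ} (hM0 : 0 ≤ M)
    (hM : ∀ x, |⟪T x, x⟫_ℝ| ≤ M * ‖x‖ ^ 2) {δ θ a : ℝ} (ha : 0 < a) (haθ : a + δ < θ)
    (hδ : ∀ x, |⟪T x - R x, x⟫_ℝ| ≤ δ * ‖x‖ ^ 2)
    {U : Submodule ℝ H} (hU : ∀ x ∈ U, θ * ‖x‖ ^ 2 ≤ ⟪R x, x⟫_ℝ)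
    {j : ℕ} (hj : j < Module.finrank ℝ U) : a ≤ eigenvalueSeq T j := by
  obtain ⟨b, l, hb, hl⟩ := exists_eigenbasis_range hT
  let s := {i // a ≤ l i}
  rcases lt_or_ge j (Fintype.card s) with hs | hs
  · let e : Fin (j + 1) ↪ s :=
      (Fin.castLEEmb hs).trans (Fintype.equivFin s).symm.toEmbedding
    have hbo : Orthonormal ℝ fun i => (b i : H) :=
      b.orthonormal.comp_linearIsometry (LinearMap.range T).subtypeₗᵢ
    exact le_eigenvalueSeq hM0 hM ha (v := fun i => (b (e i).1 : H))
      (hbo.comp (fun i => (e i).1) (Subtype.val_injective.comp e.injective))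
      fun i => ⟨l (e i).1, (e i).2, hb _⟩
  exfalso
  let f : U →ₗ[ℝ] s → ℝ := LinearMap.pi fun i => (innerₗ H (b i.1 : H)) ∘ₗ U.subtype
  have : FiniteDimensional ℝ U := Module.finite_of_finrank_pos (by omega)
  have hker : LinearMap.ker f ≠ ⊥ :=
    LinearMap.ker_ne_bot_of_finrank_lt (by rw [Module.finrank_fintype_fun_eq_card]; omega)
  obtain ⟨⟨x, hxU⟩, hfx, hx0⟩ := Submodule.exists_mem_ne_zero_of_ne_bot hker
  have hx0' : x ≠ 0 := fun h => hx0 (Subtype.ext h)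
  have horth : ∀ i : s, ⟪(b i.1 : H), x⟫_ℝ = 0 := fun i => congrFun (LinearMap.mem_ker.1 hfx) i
  -- The eigenbasis spans only the range of `T`, where `x` need not lie. By symmetry the form of `T`
  -- sees only the projection of `x`.
  let y := (LinearMap.range T).orthogonalProjectionOnto x
  have hperp : ∀ z ∈ LinearMap.range T, ⟪z, x⟫_ℝ = ⟪z, (y : H)⟫_ℝ := fun z hz => by
    have : ⟪x - y, z⟫_ℝ = 0 := (LinearMap.range T).starProjection_inner_eq_zero x z hz
    rw [inner_sub_left, sub_eq_zero] at this
    rw [real_inner_comm, this, real_inner_comm]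
  have hTxy : T x = T y := by
    refine ext_inner_left ℝ fun z => ?_
    rw [← hT, ← hT, hperp _ ⟨z, rfl⟩]
  have h1 : ⟪T x, x⟫_ℝ ≤ a * ‖x‖ ^ 2 := by
    rw [hperp _ ⟨x, rfl⟩, hTxy, hl y]
    calc ∑ i, l i * ⟪(b i : H), (y : H)⟫_ℝ ^ 2 ≤ ∑ i, a * ⟪(b i : H), (y : H)⟫_ℝ ^ 2 := by
          refine Finset.sum_le_sum fun i _ => ?_
          by_cases hi : a ≤ l i
          · rw [← hperp _ (b i).2, horth ⟨i, hi⟩]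
            simp
          · exact mul_le_mul_of_nonneg_right (le_of_not_ge hi) (sq_nonneg _)
      _ = a * ‖(y : H)‖ ^ 2 := by
          have h2 := b.sum_sq_inner_right y
          simp only [Submodule.coe_inner, Submodule.coe_norm] at h2
          rw [← Finset.mul_sum, h2]
      _ ≤ a * ‖x‖ ^ 2 := by
          gcongr
          exact (LinearMap.range T).norm_orthogonalProjectionOnto_apply_le x
  have h2 := (abs_le.1 (hδ x)).1
  rw [inner_sub_left] at h2
  have h3 := hU x hxU
  have h4 : 0 < ‖x‖ ^ 2 := by positivity
  nlinarith

/-- Finite-dimensional subspaces are closed, so the closures drop out; the inclusion in the range of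
`C` comes first, to make the range of `R` finite-dimensional. -/
theorem finrank_range_eq_of_rangeEquivalent {R C : H →ₗ[ℝ] H} (h : RangeEquivalent R C) {d : ℕ}
    (hd : C.rank = d) :
    FiniteDimensional ℝ (LinearMap.range R) ∧ Module.finrank ℝ (LinearMap.range R) = d := by
  have hC : FiniteDimensional ℝ (LinearMap.range C) := Module.finite_of_rank_eq_nat hd
  have hRC : (LinearMap.range R : Set H) ⊆ LinearMap.range C := by
    rw [← (Submodule.closed_of_finiteDimensional (LinearMap.range C)).closure_eq, ← h]
    exact subset_closure
  have hR : FiniteDimensional ℝ (LinearMap.range R) :=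
    Submodule.finiteDimensional_of_le (SetLike.coe_subset_coe.1 hRC)
  have heq : LinearMap.range R = LinearMap.range C := by
    refine SetLike.coe_injective ?_
    rw [← (Submodule.closed_of_finiteDimensional (LinearMap.range C)).closure_eq, ← h,
      (Submodule.closed_of_finiteDimensional (LinearMap.range R)).closure_eq]
  refine ⟨hR, ?_⟩
  rw [heq]
  exact Module.finrank_eq_of_rank_eq hd

end Spectral

/-! ### Integral operators: norm bound, adjoint, finite rank. -/

section Kernels

variable {μ : Measure ℝ}

open scoped InnerProductSpace

theorem real_inner_Lp_eq (f g : Lp ℝ 2 μ) : ⟪f, g⟫_ℝ = ∫ x, f x * g x ∂μ := by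
  rw [L2.inner_def]
  refine integral_congr_ae (Eventually.of_forall fun x => ?_)
  simp [mul_comm]

theorem norm_sq_Lp_eq (f : Lp ℝ 2 μ) : ‖f‖ ^ 2 = ∫ x, f x ^ 2 ∂μ := by
  rw [← real_inner_self_eq_norm_sq, real_inner_Lp_eq]
  simp only [sq]

variable [IsFiniteMeasure μ]

theorem coeFn_integralOp (K : ℝ → ℝ → ℝ) (hK : MemLp (Function.uncurry K) 2 (μ.prod μ))
    (f : Lp ℝ 2 μ) : integralOp K hK f =ᵐ[μ] fun x => ∫ y, K x y * f y ∂μ :=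
  (memLp_integral_kernel hK (Lp.memLp f)).coeFn_toLp

/-- Cauchy–Schwarz on almost every slice: the Hilbert–Schmidt norm dominates the operator norm. -/
theorem norm_integralOp_sq_le (K : ℝ → ℝ → ℝ) (hK : MemLp (Function.uncurry K) 2 (μ.prod μ))
    (f : Lp ℝ 2 μ) :
    ‖integralOp K hK f‖ ^ 2 ≤ (∫ z, Function.uncurry K z ^ 2 ∂μ.prod μ) * ‖f‖ ^ 2 := by
  have hK2 := (memLp_two_iff_integrable_sq hK.1).1 hK
  rw [norm_sq_Lp_eq, norm_sq_Lp_eq, integral_prod _ hK2, ← integral_mul_const]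
  refine integral_mono_ae (Lp.memLp _).integrable_sq (hK2.integral_prod_left.mul_const _) ?_
  filter_upwards [coeFn_integralOp K hK f, ae_slice_memLp hK] with x hx hx'
  rw [hx]
  exact sq_integral_mul_le hx' (Lp.memLp f)

theorem integralOp_sub_apply {K L : ℝ → ℝ → ℝ} (hK : MemLp (Function.uncurry K) 2 (μ.prod μ))
    (hL : MemLp (Function.uncurry L) 2 (μ.prod μ)) (f : Lp ℝ 2 μ) :
    integralOp K hK f - integralOp L hL f
      = integralOp (fun x y => K x y - L x y) (hK.sub hL) f := by
  refine Lp.ext ?_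
  filter_upwards [Lp.coeFn_sub (integralOp K hK f) (integralOp L hL f), coeFn_integralOp K hK f,
    coeFn_integralOp L hL f, coeFn_integralOp (fun x y => K x y - L x y) (hK.sub hL) f,
    ae_slice_memLp hK, ae_slice_memLp hL] with x h1 h2 h3 h4 h5 h6
  have i5 : Integrable (fun y => K x y * f y) μ := h5.integrable_mul (Lp.memLp f)
  have i6 : Integrable (fun y => L x y * f y) μ := h6.integrable_mul (Lp.memLp f)
  rw [h1, Pi.sub_apply, h2, h3, h4, ← integral_sub i5 i6]
  exact integral_congr_ae (Eventually.of_forall fun y => by simp [sub_mul])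

theorem integrable_Lp (f : Lp ℝ 2 μ) : Integrable f μ :=
  (Lp.memLp f).integrable one_le_two

/-- Fubini: transposing the kernel gives the adjoint. Boundedness of `K` supplies the integrability.
-/
theorem inner_integralOp_left {K : ℝ → ℝ → ℝ} (hm : Measurable (Function.uncurry K)) {M : ℝ}
    (hb : ∀ x y, |K x y| ≤ M) (hK : MemLp (Function.uncurry K) 2 (μ.prod μ))
    (hK' : MemLp (Function.uncurry fun x y => K y x) 2 (μ.prod μ)) (f g : Lp ℝ 2 μ) :
    ⟪integralOp K hK f, g⟫_ℝ = ⟪f, integralOp (fun x y => K y x) hK' g⟫_ℝ := by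
  have hint : Integrable (Function.uncurry fun x y => K x y * (g x * f y)) (μ.prod μ) :=
    ((integrable_Lp g).mul_prod (integrable_Lp f)).bdd_mul hm.aestronglyMeasurable
      (Eventually.of_forall fun z => hb z.1 z.2)
  rw [real_inner_Lp_eq, real_inner_Lp_eq]
  calc ∫ x, integralOp K hK f x * g x ∂μ = ∫ x, ∫ y, K x y * (g x * f y) ∂μ ∂μ := by
        refine integral_congr_ae ?_
        filter_upwards [coeFn_integralOp K hK f] with x hx
        rw [hx, ← integral_mul_const]
        exact integral_congr_ae (Eventually.of_forall fun y => by ring)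
    _ = ∫ y, ∫ x, K x y * (g x * f y) ∂μ ∂μ := integral_integral_swap hint
    _ = ∫ y, f y * integralOp (fun x y => K y x) hK' g y ∂μ := by
        refine integral_congr_ae ?_
        filter_upwards [coeFn_integralOp _ hK' g] with y hy
        rw [hy, ← integral_const_mul]
        exact integral_congr_ae (Eventually.of_forall fun x => by ring)

theorem isSymmetric_integralOp {K : ℝ → ℝ → ℝ} (hm : Measurable (Function.uncurry K)) {M : ℝ}
    (hb : ∀ x y, |K x y| ≤ M) (hK : MemLp (Function.uncurry K) 2 (μ.prod μ))
    (hs : ∀ x y, K x y = K y x) : (integralOp K hK).IsSymmetric := by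
  intro f g
  have e : (fun x y => K y x) = K := by
    funext x y
    exact hs y x
  have := inner_integralOp_left hm hb hK (by rw [e]; exact hK) f g
  simpa only [e] using this

/-- With a separable kernel, every image is a combination of the finitely many `u i`. -/
theorem finiteDimensional_range_integralOp {ι : Type*} (s : Finset ι) {u w : ι → ℝ → ℝ}
    (hu : ∀ i, MemLp (u i) 2 μ) (hw : ∀ i, MemLp (w i) 2 μ) {K : ℝ → ℝ → ℝ}
    (hK : MemLp (Function.uncurry K) 2 (μ.prod μ)) (hKs : ∀ x y, K x y = ∑ i ∈ s, u i x * w i y) :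
    FiniteDimensional ℝ (LinearMap.range (integralOp K hK)) := by
  classical
  have hle : LinearMap.range (integralOp K hK)
      ≤ Submodule.span ℝ (s.image fun i => (hu i).toLp (u i) : Finset (Lp ℝ 2 μ)) := by
    rintro _ ⟨f, rfl⟩
    have e : integralOp K hK f = ∑ i ∈ s, (∫ y, w i y * f y ∂μ) • (hu i).toLp (u i) := by
      refine Lp.ext ?_
      have hcoe : ∀ᵐ x ∂μ, ∀ i ∈ s,
          ((∫ y, w i y * f y ∂μ) • (hu i).toLp (u i) : Lp ℝ 2 μ) x
            = (∫ y, w i y * f y ∂μ) * u i x := by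
        rw [eventually_all_finset]
        intro i _
        filter_upwards [Lp.coeFn_smul (∫ y, w i y * f y ∂μ) ((hu i).toLp (u i)),
          (hu i).coeFn_toLp] with x h1 h2
        rw [h1, Pi.smul_apply, h2, smul_eq_mul]
      filter_upwards [coeFn_integralOp K hK f, hcoe,
        Lp.coeFn_finsetSum s fun i => (∫ y, w i y * f y ∂μ) • (hu i).toLp (u i)] with x h1 h2 h3
      rw [h1, h3, Finset.sum_apply, Finset.sum_congr rfl h2]
      simp only [hKs, Finset.sum_mul]
      rw [integral_finsetSum]
      · refine Finset.sum_congr rfl fun i _ => ?_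
        rw [← integral_mul_const]
        exact integral_congr_ae (Eventually.of_forall fun y => by ring)
      · intro i _
        simp only [mul_assoc]
        exact ((hw i).integrable_mul (Lp.memLp f)).const_mul _
    rw [e]
    exact Submodule.sum_mem _ fun i hi => Submodule.smul_mem _ _
      (Submodule.subset_span (Finset.mem_coe.2 (Finset.mem_image_of_mem _ hi)))
  exact Submodule.finiteDimensional_of_le hle

end Kernels

/-! ### The operator with kernel `sumSqKernel`: positivity and continuity in the covariances. -/

section SumSqKernel

variable {μ : Measure ℝ} {C : ℕ → ℝ → ℝ → ℝ}

open scoped InnerProductSpace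

theorem sumSqKernel_symm (p : ℕ) (x y : ℝ) : sumSqKernel μ p C x y = sumSqKernel μ p C y x := by
  simp only [sumSqKernel, mul_comm]

variable [IsFiniteMeasure μ]

theorem abs_sumSqKernel_le {M : ℝ} (hb : ∀ k x y, |C k x y| ≤ M) (p : ℕ) (x y : ℝ) :
    |sumSqKernel μ p C x y| ≤ ∑ _k ∈ Finset.Icc 1 p, M * M * μ.real Set.univ := by
  refine (Finset.abs_sum_le_sum_abs _ _).trans (Finset.sum_le_sum fun k _ => ?_)
  rw [← Real.norm_eq_abs]
  refine norm_integral_le_of_norm_le_const (Eventually.of_forall fun z => ?_)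
  rw [Real.norm_eq_abs, abs_mul]
  exact mul_le_mul (hb k x z) (hb k y z) (abs_nonneg _) ((abs_nonneg _).trans (hb k x z))

theorem measurable_sumSqKernel (hm : ∀ k, Measurable (Function.uncurry (C k))) (p : ℕ) :
    Measurable (Function.uncurry (sumSqKernel μ p C)) := by
  have hh : ∀ k, Measurable fun w : (ℝ × ℝ) × ℝ => C k w.1.1 w.2 * C k w.1.2 w.2 := fun k =>
    ((hm k).comp (measurable_fst.fst.prodMk measurable_snd)).mul
      ((hm k).comp (measurable_fst.snd.prodMk measurable_snd))
  change Measurable fun w : ℝ × ℝ => ∑ k ∈ Finset.Icc 1 p, ∫ z, C k w.1 z * C k w.2 z ∂μ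
  exact Finset.measurable_fun_sum _ fun k _ =>
    ((hh k).stronglyMeasurable.integral_prod_right' (ν := μ)).measurable

theorem isSymmetric_integralOp_sumSqKernel
    (hm : ∀ k, Measurable (Function.uncurry (C k))) {M : ℝ}
    (hb : ∀ k x y, |C k x y| ≤ M) (p : ℕ)
    (hK : MemLp (Function.uncurry (sumSqKernel μ p C)) 2 (μ.prod μ)) :
    (integralOp (sumSqKernel μ p C) hK).IsSymmetric :=
  isSymmetric_integralOp (measurable_sumSqKernel hm p) (abs_sumSqKernel_le hb p) hK
    (sumSqKernel_symm p)

theorem integrable_kernel_mul_kernel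
    (hm : ∀ k, Measurable (Function.uncurry (C k))) {M : ℝ}
    (hb : ∀ k x y, |C k x y| ≤ M) (k : ℕ) (x y : ℝ) :
    Integrable (fun z => C k x z * C k y z) μ :=
  Integrable.of_bound (((hm k).of_uncurry_left.mul (hm k).of_uncurry_left).aestronglyMeasurable)
    (M * M) (Eventually.of_forall fun z => by
      rw [Real.norm_eq_abs, abs_mul]
      exact mul_le_mul (hb k x z) (hb k y z) (abs_nonneg _) ((abs_nonneg _).trans (hb k x z)))

/-- This is the factorization `R = ∑ C_k C_k*`, from which positivity is read off. -/
theorem integralOp_sumSqKernel_apply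
    (hm : ∀ k, Measurable (Function.uncurry (C k))) {M : ℝ}
    (hb : ∀ k x y, |C k x y| ≤ M) (p : ℕ)
    (hK : MemLp (Function.uncurry (sumSqKernel μ p C)) 2 (μ.prod μ))
    (h1 : ∀ k, MemLp (Function.uncurry (C k)) 2 (μ.prod μ))
    (h2 : ∀ k, MemLp (Function.uncurry fun x y => C k y x) 2 (μ.prod μ)) (f : Lp ℝ 2 μ) :
    integralOp (sumSqKernel μ p C) hK f = ∑ k ∈ Finset.Icc 1 p,
      integralOp (C k) (h1 k) (integralOp (fun x y => C k y x) (h2 k) f) := by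
  refine Lp.ext ?_
  have hcoe : ∀ᵐ x ∂μ, ∀ k ∈ Finset.Icc 1 p,
      integralOp (C k) (h1 k) (integralOp (fun x y => C k y x) (h2 k) f) x
        = ∫ z, C k x z * ∫ y, C k y z * f y ∂μ ∂μ := by
    rw [eventually_all_finset]
    intro k _
    filter_upwards [coeFn_integralOp (C k) (h1 k) (integralOp (fun x y => C k y x) (h2 k) f)]
      with x hx
    rw [hx]
    refine integral_congr_ae ?_
    filter_upwards [coeFn_integralOp _ (h2 k) f] with z hz
    rw [hz]
  filter_upwards [coeFn_integralOp _ hK f, hcoe, Lp.coeFn_finsetSum (Finset.Icc 1 p) fun k =>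
    integralOp (C k) (h1 k) (integralOp (fun x y => C k y x) (h2 k) f)] with x e1 e2 e3
  rw [e1, e3, Finset.sum_apply, Finset.sum_congr rfl e2]
  have hint : ∀ k, Integrable (Function.uncurry fun y z => C k x z * C k y z * f y)
      (μ.prod μ) := fun k => by
    refine ((integrable_Lp f).comp_fst μ).bdd_mul (c := M * M)
      (((hm k).comp (measurable_const.prodMk measurable_snd)).mul
        (hm k)).aestronglyMeasurable (Eventually.of_forall fun z => ?_)
    rw [Real.norm_eq_abs]
    rw [abs_mul]
    exact mul_le_mul (hb k x _) (hb k _ _) (abs_nonneg _) ((abs_nonneg _).trans (hb k x 0))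
  simp only [sumSqKernel, Finset.sum_mul]
  have hrw : ∀ k y, (∫ z, C k x z * C k y z ∂μ) * f y = ∫ z, C k x z * C k y z * f y ∂μ :=
    fun k y => (integral_mul_const _ _).symm
  simp only [hrw]
  have hint' : ∀ k, Integrable (fun y => ∫ z, C k x z * C k y z * f y ∂μ) μ := fun k =>
    (hint k).integral_prod_left
  rw [integral_finsetSum _ fun k _ => hint' k]
  refine Finset.sum_congr rfl fun k _ => ?_
  rw [integral_integral_swap (hint k)]
  refine integral_congr_ae (Eventually.of_forall fun z => ?_)
  simp only [mul_assoc, integral_const_mul]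

theorem inner_integralOp_sumSqKernel_nonneg
    (hm : ∀ k, Measurable (Function.uncurry (C k))) {M : ℝ}
    (hb : ∀ k x y, |C k x y| ≤ M) (p : ℕ)
    (hK : MemLp (Function.uncurry (sumSqKernel μ p C)) 2 (μ.prod μ)) (f : Lp ℝ 2 μ) :
    0 ≤ ⟪integralOp (sumSqKernel μ p C) hK f, f⟫_ℝ := by
  have h1 : ∀ k, MemLp (Function.uncurry (C k)) 2 (μ.prod μ) := fun k =>
    memLp_of_bounded (hm k) (hb k)
  have h2 : ∀ k, MemLp (Function.uncurry fun x y => C k y x) 2 (μ.prod μ) := fun k =>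
    memLp_of_bounded ((hm k).comp measurable_swap) fun x y => hb k y x
  rw [integralOp_sumSqKernel_apply hm hb p hK h1 h2, sum_inner]
  refine Finset.sum_nonneg fun k _ => ?_
  rw [inner_integralOp_left (hm k) (hb k) (h1 k) (h2 k)]
  exact real_inner_self_nonneg

/-- Cauchy–Schwarz is applied to the sum over `k` (the factor `p`) and to each integral over `z`.
One factor 2 comes from splitting the difference of products, the other from integrating `D k x + D
k y` over both variables. -/
theorem integral_sumSqKernel_sub_sq_le
    (hm : ∀ k, Measurable (Function.uncurry (C k))) {M : ℝ}
    (hb : ∀ k x y, |C k x y| ≤ M) {C' : ℕ → ℝ → ℝ → ℝ}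
    (hm' : ∀ k, Measurable (Function.uncurry (C' k))) (hb' : ∀ k x y, |C' k x y| ≤ M) (p : ℕ) :
    ∫ z, Function.uncurry (fun x y => sumSqKernel μ p C x y - sumSqKernel μ p C' x y) z ^ 2
        ∂μ.prod μ
      ≤ 4 * p * M ^ 2 * μ.real Set.univ ^ 2 *
        ∑ k ∈ Finset.Icc 1 p, ∫ z, (C k z.1 z.2 - C' k z.1 z.2) ^ 2 ∂μ.prod μ := by
  have hM : 0 ≤ M := (abs_nonneg _).trans (hb 0 0 0)
  have hΔm : ∀ k, Measurable fun z : ℝ × ℝ => C k z.1 z.2 - C' k z.1 z.2 := fun k =>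
    (hm k).sub (hm' k)
  have hΔb : ∀ k x y, |C k x y - C' k x y| ≤ 2 * M := fun k x y =>
    (abs_sub _ _).trans (by linarith [hb k x y, hb' k x y])
  have hΔ2 : ∀ k x y, ‖(C k x y - C' k x y) ^ 2‖ ≤ (2 * M) ^ 2 := fun k x y => by
    rw [norm_pow, Real.norm_eq_abs]
    exact pow_le_pow_left₀ (abs_nonneg _) (hΔb k x y) 2
  have hi2 : ∀ k, Integrable (fun z : ℝ × ℝ => (C k z.1 z.2 - C' k z.1 z.2) ^ 2) (μ.prod μ) :=
    fun k => Integrable.of_bound ((hΔm k).pow_const 2).aestronglyMeasurable ((2 * M) ^ 2)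
      (Eventually.of_forall fun z => hΔ2 k z.1 z.2)
  let D : ℕ → ℝ → ℝ := fun k x => ∫ z, (C k x z - C' k x z) ^ 2 ∂μ
  have hDint : ∀ k, Integrable (D k) μ := fun k => (hi2 k).integral_prod_left
  have hslice : ∀ k x, MemLp (fun z => C k x z - C' k x z) 2 μ := fun k x =>
    MemLp.of_bound ((hΔm k).comp (measurable_const.prodMk measurable_id)).aestronglyMeasurable
      (2 * M) (Eventually.of_forall fun z => hΔb k x z)
  have hCslice : ∀ k x, MemLp (fun z => C k x z) 2 μ := fun k x =>
    MemLp.of_bound (hm k).of_uncurry_left.aestronglyMeasurable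
      M (Eventually.of_forall fun z => hb k x z)
  have hCslice' : ∀ k x, MemLp (fun z => C' k x z) 2 μ := fun k x =>
    MemLp.of_bound (hm' k).of_uncurry_left.aestronglyMeasurable
      M (Eventually.of_forall fun z => hb' k x z)
  have hsq : ∀ f : ℝ → ℝ, MemLp f 2 μ → (∀ z, |f z| ≤ M) →
      ∫ z, f z ^ 2 ∂μ ≤ M ^ 2 * μ.real Set.univ := fun f hf hfb => by
    have := integral_mono hf.integrable_sq (integrable_const (M ^ 2)) fun z => by
      simpa using sq_le_sq' (abs_le.1 (hfb z)).1 (abs_le.1 (hfb z)).2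
    simpa [mul_comm] using this
  have hpt : ∀ x y, (sumSqKernel μ p C x y - sumSqKernel μ p C' x y) ^ 2
      ≤ p * ∑ k ∈ Finset.Icc 1 p, 2 * (M ^ 2 * μ.real Set.univ) * (D k x + D k y) := by
    intro x y
    -- Telescoping `C C - C' C'` leaves one factor `C - C'` in each term.
    have e : sumSqKernel μ p C x y - sumSqKernel μ p C' x y = ∑ k ∈ Finset.Icc 1 p,
        ((∫ z, (C k y z - C' k y z) * C k x z ∂μ) + ∫ z, (C k x z - C' k x z) * C' k y z ∂μ) := by
      rw [sumSqKernel, sumSqKernel, ← Finset.sum_sub_distrib]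
      refine Finset.sum_congr rfl fun k _ => ?_
      have i1 : Integrable (fun z => (C k y z - C' k y z) * C k x z) μ :=
        (hslice k y).integrable_mul (hCslice k x)
      have i2 : Integrable (fun z => (C k x z - C' k x z) * C' k y z) μ :=
        (hslice k x).integrable_mul (hCslice' k y)
      rw [← integral_sub (integrable_kernel_mul_kernel hm hb k x y)
        (integrable_kernel_mul_kernel hm' hb' k x y), ← integral_add i1 i2]
      exact integral_congr_ae (Eventually.of_forall fun z => by simp; ring)
    rw [e]
    refine sq_sum_le_card_mul_sum_sq.trans ?_
    rw [Nat.card_Icc, Nat.add_sub_cancel]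
    gcongr with k _
    have h1 := (sq_integral_mul_le (hslice k y) (hCslice k x)).trans
      (mul_le_mul_of_nonneg_left (hsq _ (hCslice k x) fun z => hb k x z)
        (integral_nonneg fun z => sq_nonneg _))
    have h2 := (sq_integral_mul_le (hslice k x) (hCslice' k y)).trans
      (mul_le_mul_of_nonneg_left (hsq _ (hCslice' k y) fun z => hb' k y z)
        (integral_nonneg fun z => sq_nonneg _))
    refine (add_sq_le.trans (mul_le_mul_of_nonneg_left (add_le_add h1 h2) zero_le_two)).trans
      (le_of_eq ?_)
    simp only [D]
    ring
  have hDi : ∀ k, Integrable (fun z : ℝ × ℝ => D k z.1 + D k z.2) (μ.prod μ) := fun k =>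
    ((hDint k).comp_fst μ).add ((hDint k).comp_snd μ)
  have hrhs : Integrable (fun z : ℝ × ℝ => (p : ℝ) * ∑ k ∈ Finset.Icc 1 p,
      2 * (M ^ 2 * μ.real Set.univ) * (D k z.1 + D k z.2)) (μ.prod μ) :=
    (integrable_finsetSum _ fun k _ => (hDi k).const_mul _).const_mul _
  have hmono := integral_mono_of_nonneg (μ := μ.prod μ) (Eventually.of_forall fun z =>
    sq_nonneg (sumSqKernel μ p C z.1 z.2 - sumSqKernel μ p C' z.1 z.2)) hrhs
    (Eventually.of_forall fun z => hpt z.1 z.2)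
  refine hmono.trans (le_of_eq ?_)
  rw [integral_const_mul, integral_finsetSum _ fun k _ => (hDi k).const_mul _, Finset.mul_sum,
    Finset.mul_sum]
  refine Finset.sum_congr rfl fun k _ => ?_
  rw [integral_const_mul, integral_add ((hDint k).comp_fst μ) ((hDint k).comp_snd μ),
    integral_fun_fst, integral_fun_snd, integral_prod _ (hi2 k)]
  simp only [D, smul_eq_mul]
  ring

end SumSqKernel

/-! ### Covariance and variance bounds under `ψ`-mixing. -/

section MixingInequality

theorem sigmaOf_mono {Ω E : Type*} [TopologicalSpace E] (Y : ℕ → Ω → E) {s t : Set ℕ} (h : s ⊆ t) :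
    sigmaOf Y s ≤ sigmaOf Y t :=
  biSup_mono fun _ hi => h hi

variable {Ω : Type*} {mA mB : MeasurableSpace Ω} [mΩ : MeasurableSpace Ω] {P : Measure Ω} [IsProbabilityMeasure P]

theorem measure_inter_le_of_psiDependence_le {ψ : ℝ≥0∞} (hψ : ψ ≠ ∞)
    (h : psiDependence P mA mB ≤ ψ) {A B : Set Ω} (hA : MeasurableSet[mA] A)
    (hB : MeasurableSet[mB] B) : P (A ∩ B) ≤ (1 + ψ) * P A * P B := by
  rcases eq_or_ne (P A) 0 with hA0 | hA0
  · exact (measure_inter_null_of_null_left B hA0).le.trans zero_le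
  rcases eq_or_ne (P B) 0 with hB0 | hB0
  · exact (measure_inter_null_of_null_right A hB0).le.trans zero_le
  have hA1 : 0 < P.real A := ENNReal.toReal_pos hA0 (measure_ne_top _ _)
  have hB1 : 0 < P.real B := ENNReal.toReal_pos hB0 (measure_ne_top _ _)
  have h1 : ENNReal.ofReal |P.real (A ∩ B) / (P.real A * P.real B) - 1| ≤ ψ := by
    refine le_trans ?_ h
    unfold psiDependence
    exact le_iSup_of_le A <| le_iSup_of_le hA <| le_iSup_of_le hA1 <| le_iSup_of_le B <|
      le_iSup_of_le hB <| le_iSup_of_le hB1 le_rfl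
  have h2 := (le_abs_self _).trans ((ENNReal.ofReal_le_iff_le_toReal hψ).1 h1)
  have h3 : P.real (A ∩ B) ≤ (1 + ψ.toReal) * P.real A * P.real B := by
    rw [sub_le_iff_le_add, div_le_iff₀ (by positivity)] at h2
    linarith
  rw [← ENNReal.toReal_le_toReal (measure_ne_top _ _) (by finiteness)]
  rw [ENNReal.toReal_mul, ENNReal.toReal_mul, ENNReal.toReal_add ENNReal.one_ne_top hψ,
    ENNReal.toReal_one]
  exact h3

/-- The set inequality says that, on `mA`, the restriction of `P` to `B` is dominated by `(1 + ψ)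
P(B) P`. Integrating `f` shows that, on `mB`, the measure with density `f` is dominated by a
multiple of `P`; then `g` is integrated. -/
theorem lintegral_mul_le_of_psiDependence_le {ψ : ℝ≥0∞} (hψ : ψ ≠ ∞)
    (h : psiDependence P mA mB ≤ ψ) {f g : Ω → ℝ≥0∞} (hf : Measurable[mA] f)
    (hg : Measurable[mB] g) (hf' : Measurable f) (hg' : Measurable g) :
    ∫⁻ ω, f ω * g ω ∂P ≤ (1 + ψ) * (∫⁻ ω, f ω ∂P) * ∫⁻ ω, g ω ∂P := by
  -- `mA` and `mB` are not assumed to be sub-σ-fields of the ambient one, which trimming a measure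
  -- requires.
  have hA : mA ⊓ mΩ ≤ mΩ := inf_le_right
  have hB : mB ⊓ mΩ ≤ mΩ := inf_le_right
  have hfA : Measurable[mA ⊓ mΩ] f := fun s hs =>
    MeasurableSpace.measurableSet_inf.2 ⟨hf hs, hf' hs⟩
  have hgB : Measurable[mB ⊓ mΩ] g := fun s hs =>
    MeasurableSpace.measurableSet_inf.2 ⟨hg hs, hg' hs⟩
  have h1 : ∀ B, MeasurableSet[mB ⊓ mΩ] B →
      ∫⁻ ω in B, f ω ∂P ≤ (1 + ψ) * (∫⁻ ω, f ω ∂P) * P B := by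
    intro B hBm
    have hle : (P.restrict B).trim hA ≤ ((1 + ψ) * P B) • P.trim hA := by
      refine Measure.le_iff.2 fun A hAm => ?_
      rw [trim_measurableSet_eq hA hAm, Measure.smul_apply, trim_measurableSet_eq hA hAm,
        Measure.restrict_apply (hA _ hAm), smul_eq_mul]
      refine (measure_inter_le_of_psiDependence_le hψ h
        (MeasurableSpace.measurableSet_inf.1 hAm).1
        (MeasurableSpace.measurableSet_inf.1 hBm).1).trans (le_of_eq (by ring))
    calc ∫⁻ ω in B, f ω ∂P = ∫⁻ ω, f ω ∂(P.restrict B).trim hA := (lintegral_trim hA hfA).symm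
      _ ≤ ∫⁻ ω, f ω ∂(((1 + ψ) * P B) • P.trim hA) := lintegral_mono' hle le_rfl
      _ = (1 + ψ) * (∫⁻ ω, f ω ∂P) * P B := by
        rw [lintegral_smul_measure, lintegral_trim hA hfA, smul_eq_mul]
        ring
  have hle : (P.withDensity f).trim hB ≤ ((1 + ψ) * ∫⁻ ω, f ω ∂P) • P.trim hB := by
    refine Measure.le_iff.2 fun B hBm => ?_
    rw [trim_measurableSet_eq hB hBm, Measure.smul_apply, trim_measurableSet_eq hB hBm,
      withDensity_apply _ (hB _ hBm), smul_eq_mul]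
    exact h1 B hBm
  calc ∫⁻ ω, f ω * g ω ∂P = ∫⁻ ω, g ω ∂(P.withDensity f).trim hB := by
        rw [lintegral_trim hB hgB, lintegral_withDensity_eq_lintegral_mul P hf' hg']
        rfl
    _ ≤ ∫⁻ ω, g ω ∂(((1 + ψ) * ∫⁻ ω, f ω ∂P) • P.trim hB) := lintegral_mono' hle le_rfl
    _ = _ := by rw [lintegral_smul_measure, lintegral_trim hB hgB, smul_eq_mul]

/-- Both integrals are at most 1, so the relative error `ψ` is also an absolute one. -/
theorem integral_mul_le_add_of_psiDependence_le {ψ : ℝ≥0∞}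
    (hψ : ψ ≠ ∞) (h : psiDependence P mA mB ≤ ψ) {f g : Ω → ℝ} (hf : Measurable[mA] f)
    (hg : Measurable[mB] g) (hf' : Measurable f) (hg' : Measurable g)
    (hf0 : ∀ ω, 0 ≤ f ω) (hf1 : ∀ ω, f ω ≤ 1) (hg0 : ∀ ω, 0 ≤ g ω) (hg1 : ∀ ω, g ω ≤ 1) :
    ∫ ω, f ω * g ω ∂P ≤ (∫ ω, f ω ∂P) * (∫ ω, g ω ∂P) + ψ.toReal := by
  have key := lintegral_mul_le_of_psiDependence_le hψ h
    (ENNReal.measurable_ofReal.comp hf) (ENNReal.measurable_ofReal.comp hg)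
    (ENNReal.measurable_ofReal.comp hf') (ENNReal.measurable_ofReal.comp hg')
  have hfin : ∀ u : Ω → ℝ, (∀ ω, u ω ≤ 1) → ∫⁻ ω, ENNReal.ofReal (u ω) ∂P ≤ 1 := fun u hu => by
    refine (lintegral_mono (g := fun _ => 1) fun ω => ?_).trans (by simp)
    exact ENNReal.ofReal_le_one.2 (hu ω)
  have e : ∀ u : Ω → ℝ, Measurable u → (∀ ω, 0 ≤ u ω) →
      ∫ ω, u ω ∂P = (∫⁻ ω, ENNReal.ofReal (u ω) ∂P).toReal := fun u hu hu0 =>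
    integral_eq_lintegral_of_nonneg_ae (Eventually.of_forall hu0) hu.aestronglyMeasurable
  have hfi := hfin f hf1
  have hgi := hfin g hg1
  have key2 := ENNReal.toReal_mono (by
    exact ENNReal.mul_ne_top (ENNReal.mul_ne_top (by finiteness)
      (ne_top_of_le_ne_top ENNReal.one_ne_top hfi)) (ne_top_of_le_ne_top ENNReal.one_ne_top hgi))
    key
  rw [ENNReal.toReal_mul, ENNReal.toReal_mul, ENNReal.toReal_add ENNReal.one_ne_top hψ,
    ENNReal.toReal_one] at key2
  have e3 : ∫ ω, f ω * g ω ∂P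
      = (∫⁻ ω, (ENNReal.ofReal ∘ f) ω * (ENNReal.ofReal ∘ g) ω ∂P).toReal := by
    rw [e (fun ω => f ω * g ω) (hf'.mul hg') fun ω => mul_nonneg (hf0 ω) (hg0 ω)]
    congr 1
    exact lintegral_congr fun ω => ENNReal.ofReal_mul (hf0 ω)
  rw [e3, e f hf' hf0, e g hg' hg0]
  have hf2 := ENNReal.toReal_mono ENNReal.one_ne_top hfi
  have hg2 := ENNReal.toReal_mono ENNReal.one_ne_top hgi
  rw [ENNReal.toReal_one] at hf2 hg2
  refine key2.trans ?_
  have hfg : (∫⁻ ω, ENNReal.ofReal (f ω) ∂P).toReal * (∫⁻ ω, ENNReal.ofReal (g ω) ∂P).toReal ≤ 1 :=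
    mul_le_one₀ hf2 ENNReal.toReal_nonneg hg2
  have := mul_le_mul_of_nonneg_left hfg (ENNReal.toReal_nonneg (a := ψ))
  simp only [Function.comp_apply]
  linarith

theorem integral_mul_le_of_psiDependence_le {ψ : ℝ≥0∞}
    (hψ : ψ ≠ ∞) (h : psiDependence P mA mB ≤ ψ) {U V : Ω → ℝ} (hU : Measurable[mA] U)
    (hV : Measurable[mB] V) (hU' : Measurable U) (hV' : Measurable V)
    (hU2 : ∀ ω, |U ω| ≤ 2) (hV2 : ∀ ω, |V ω| ≤ 2) (hU0 : ∫ ω, U ω ∂P = 0)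
    (hV0 : ∫ ω, V ω ∂P = 0) : ∫ ω, U ω * V ω ∂P ≤ 16 * ψ.toReal := by
  have iU : Integrable U P := Integrable.of_bound hU'.aestronglyMeasurable 2
    (Eventually.of_forall hU2)
  have iV : Integrable V P := Integrable.of_bound hV'.aestronglyMeasurable 2
    (Eventually.of_forall hV2)
  have iUV : Integrable (fun ω => U ω * V ω) P :=
    iV.bdd_mul hU'.aestronglyMeasurable (Eventually.of_forall hU2)
  -- This affine map sends `[-2, 2]` to `[0, 1]`; undoing it in both factors costs `4² = 16`.
  have hT : Measurable fun x : ℝ => (x + 2) / 4 := by fun_prop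
  have key := integral_mul_le_add_of_psiDependence_le hψ h (hT.comp hU) (hT.comp hV)
    (hT.comp hU') (hT.comp hV')
    (fun ω => by simp only [Function.comp]; linarith [(abs_le.1 (hU2 ω)).1])
    (fun ω => by simp only [Function.comp]; linarith [(abs_le.1 (hU2 ω)).2])
    (fun ω => by simp only [Function.comp]; linarith [(abs_le.1 (hV2 ω)).1])
    (fun ω => by simp only [Function.comp]; linarith [(abs_le.1 (hV2 ω)).2])
  simp only [Function.comp_apply] at key
  have e : ∀ W : Ω → ℝ, Integrable W P → ∫ ω, W ω ∂P = 0 → ∫ ω, (W ω + 2) / 4 ∂P = 1 / 2 :=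
    fun W hW h0 => by
      rw [integral_div, integral_add hW (integrable_const _), h0]
      simp
      norm_num
  have e3 : ∫ ω, (U ω + 2) / 4 * ((V ω + 2) / 4) ∂P = (∫ ω, U ω * V ω ∂P) / 16 + 1 / 4 := by
    have : ∀ ω, (U ω + 2) / 4 * ((V ω + 2) / 4)
        = 1 / 16 * (U ω * V ω) + (1 / 8 * U ω + 1 / 8 * V ω + 1 / 4) := fun ω => by ring
    simp only [this]
    have i1 : Integrable (fun ω => 1 / 8 * U ω + 1 / 8 * V ω) P :=
      (iU.const_mul _).add (iV.const_mul _)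
    have i2 : Integrable (fun ω => 1 / 8 * U ω + 1 / 8 * V ω + 1 / 4) P :=
      i1.add (integrable_const _)
    rw [integral_add (iUV.const_mul _) i2, integral_add i1 (integrable_const _),
      integral_add (iU.const_mul _) (iV.const_mul _), integral_const_mul, integral_const_mul,
      integral_const_mul, hU0, hV0]
    simp
    ring
  rw [e U iU hU0, e V iV hV0, e3] at key
  linarith

/-- On each side of `s` the lag determines `t`, so each side contributes at most the full series. -/
theorem sum_lag_le_two_mul_tsum {b : ℕ → ℝ} (hb0 : ∀ j, 0 ≤ b j) (hb : Summable b)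
    (u : Finset ℕ) (s : ℕ) :
    ∑ t ∈ u, (if s ≤ t then b (t - s) else b (s - t)) ≤ 2 * ∑' j, b j := by
  rw [Finset.sum_ite, two_mul]
  refine add_le_add ?_ ?_
  · rw [← Finset.sum_image (f := b) (g := fun t => t - s)]
    · exact hb.sum_le_tsum _ fun j _ => hb0 j
    · intro x hx y hy hxy
      simp only [Finset.coe_filter, Set.mem_ofPred_eq] at hx hy hxy
      omega
  · rw [← Finset.sum_image (f := b) (g := fun t => s - t)]
    · exact hb.sum_le_tsum _ fun j _ => hb0 j
    · intro x hx y hy hxy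
      simp only [Finset.coe_filter, Set.mem_ofPred_eq] at hx hy hxy
      omega

theorem integral_sum_sq_le {H : ℕ → Ω → ℝ} (hH : ∀ t, Measurable (H t))
    {M : ℝ} (hM : ∀ t ω, |H t ω| ≤ M) {b : ℕ → ℝ} (hb0 : ∀ j, 0 ≤ b j) (hb : Summable b)
    (hcov : ∀ s t, 1 ≤ s → s ≤ t → ∫ ω, H s ω * H t ω ∂P ≤ b (t - s)) (N : ℕ) :
    ∫ ω, (∑ t ∈ Finset.Icc 1 N, H t ω) ^ 2 ∂P ≤ 2 * N * ∑' j, b j := by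
  have hint : ∀ s t, Integrable (fun ω => H s ω * H t ω) P := fun s t =>
    (Integrable.of_bound (hH t).aestronglyMeasurable M (Eventually.of_forall (hM t))).bdd_mul
      (hH s).aestronglyMeasurable (Eventually.of_forall (hM s))
  have e : ∫ ω, (∑ t ∈ Finset.Icc 1 N, H t ω) ^ 2 ∂P
      = ∑ s ∈ Finset.Icc 1 N, ∑ t ∈ Finset.Icc 1 N, ∫ ω, H s ω * H t ω ∂P := by
    simp only [sq, Finset.sum_mul_sum]
    rw [integral_finsetSum _ fun s _ => integrable_finsetSum _ fun t _ => hint s t]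
    exact Finset.sum_congr rfl fun s _ => integral_finsetSum _ fun t _ => hint s t
  rw [e]
  calc ∑ s ∈ Finset.Icc 1 N, ∑ t ∈ Finset.Icc 1 N, ∫ ω, H s ω * H t ω ∂P
      ≤ ∑ s ∈ Finset.Icc 1 N, ∑ t ∈ Finset.Icc 1 N, (if s ≤ t then b (t - s) else b (s - t)) := by
        refine Finset.sum_le_sum fun s hs => Finset.sum_le_sum fun t ht => ?_
        rw [Finset.mem_Icc] at hs ht
        split_ifs with hst
        · exact hcov s t hs.1 hst
        · simp only [mul_comm (H s _)]
          exact hcov t s ht.1 (by omega)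
    _ ≤ ∑ s ∈ Finset.Icc 1 N, 2 * ∑' j, b j :=
        Finset.sum_le_sum fun s _ => sum_lag_le_two_mul_tsum hb0 hb _ s
    _ = 2 * N * ∑' j, b j := by
        simp only [Finset.sum_const, Nat.card_Icc, Nat.add_sub_cancel, nsmul_eq_mul]
        ring

/-- A bound, summable in the lag, for the covariances of a sequence of centred functions of
`k + 1` consecutive terms of a `ψ`-mixing sequence. -/
def lagBound (ψ : ℕ → ℝ≥0∞) (k j : ℕ) : ℝ :=
  if j ≤ k then 4 else 16 * (ψ (j - k)).toReal

theorem lagBound_nonneg (ψ : ℕ → ℝ≥0∞) (k j : ℕ) : 0 ≤ lagBound ψ k j := by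
  unfold lagBound
  split_ifs <;> positivity

theorem summable_lagBound {ψ : ℕ → ℝ≥0∞} (h : Summable fun j => (ψ (j + 1)).toReal) (k : ℕ) :
    Summable (lagBound ψ k) := by
  rw [← summable_nat_add_iff (k + 1)]
  refine (h.mul_left 16).congr fun j => ?_
  have h1 : ¬ j + (k + 1) ≤ k := by omega
  have h2 : j + (k + 1) - k = j + 1 := by omega
  simp [lagBound, h1, h2]

/-- Since `H t` depends on the terms `t, …, t + k`, a lag `j > k` leaves a gap `j - k` to which
mixing applies. At smaller lags the trivial bound `2 · 2 = 4` is used. -/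
theorem integral_sum_sq_le_of_mixing {E : Type*} [TopologicalSpace E] {Y : ℕ → Ω → E}
    (hfin : ∀ j, psiMixingCoeff P Y (j + 1) ≠ ∞)
    (hsum : Summable fun j => (psiMixingCoeff P Y (j + 1)).toReal) (k : ℕ)
    {H : ℕ → Ω → ℝ} (hH : ∀ t, Measurable (H t))
    (hHY : ∀ t, Measurable[sigmaOf Y (Set.Icc t (t + k))] (H t))
    (hH2 : ∀ t ω, |H t ω| ≤ 2) (hH0 : ∀ t, ∫ ω, H t ω ∂P = 0) (N : ℕ) :
    ∫ ω, (∑ t ∈ Finset.Icc 1 N, H t ω) ^ 2 ∂P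
      ≤ 2 * N * ∑' j, lagBound (psiMixingCoeff P Y) k j := by
  refine integral_sum_sq_le hH hH2 (lagBound_nonneg _ k) (summable_lagBound hsum k) ?_ N
  intro s t hs hst
  unfold lagBound
  split_ifs with hk
  · have := norm_integral_le_of_norm_le_const (μ := P) (f := fun ω => H s ω * H t ω) (C := 4)
      (Eventually.of_forall fun ω => by
        rw [Real.norm_eq_abs, abs_mul]
        nlinarith [hH2 s ω, hH2 t ω, abs_nonneg (H s ω), abs_nonneg (H t ω)])
    rw [probReal_univ, mul_one] at this
    exact (le_abs_self _).trans this
  -- The gap is written as a successor because the coefficients are known to be finite only from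
  -- index 1 on.
  · obtain ⟨j, hj⟩ : ∃ j, t - s - k = j + 1 := ⟨t - s - k - 1, by omega⟩
    rw [hj]
    refine integral_mul_le_of_psiDependence_le (hfin j)
      (mA := sigmaOf Y (Set.Icc 1 (s + k))) (mB := sigmaOf Y (Set.Ici (s + k + (j + 1))))
      (le_iSup (fun J => psiDependence P (sigmaOf Y (Set.Icc 1 J))
        (sigmaOf Y (Set.Ici (J + (j + 1))))) (s + k))
      ((hHY s).mono (sigmaOf_mono Y (Set.Icc_subset_Icc_left hs)) le_rfl)
      ((hHY t).mono (sigmaOf_mono Y fun i hi => ?_) le_rfl)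
      (hH s) (hH t) (hH2 s) (hH2 t) (hH0 s) (hH0 t)
    simp only [Set.mem_Icc, Set.mem_Ici] at hi ⊢
    omega

/-- If the square roots sum to `S`, each is at most `S`, so `ψ ≤ S ψ^{1/2}` termwise. The weight `k
+ 1 ≥ 1` is simply dropped. -/
theorem psiMixingCoeff_summable {ψ : ℕ → ℝ≥0∞}
    (h : ∑' k : ℕ, ((k + 1 : ℕ) : ℝ≥0∞) * ψ (k + 1) ^ (1 / 2 : ℝ) < ∞) :
    (∀ j, ψ (j + 1) ≠ ∞) ∧ Summable fun j => (ψ (j + 1)).toReal := by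
  have hle : ∀ j : ℕ, ψ (j + 1) ^ (1 / 2 : ℝ) ≤ ((j + 1 : ℕ) : ℝ≥0∞) * ψ (j + 1) ^ (1 / 2 : ℝ) :=
    fun j => le_mul_of_one_le_left zero_le (by simp)
  have h1 : ∑' j, ψ (j + 1) ^ (1 / 2 : ℝ) < ∞ := (ENNReal.tsum_le_tsum hle).trans_lt h
  set S := ∑' j, ψ (j + 1) ^ (1 / 2 : ℝ) with hS
  have hj : ∀ j, ψ (j + 1) ≤ S * ψ (j + 1) ^ (1 / 2 : ℝ) := fun j => by
    have e : ψ (j + 1) = ψ (j + 1) ^ (1 / 2 : ℝ) * ψ (j + 1) ^ (1 / 2 : ℝ) := by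
      rw [← ENNReal.rpow_add_of_nonneg _ _ (by norm_num) (by norm_num)]
      norm_num
    conv_lhs => rw [e]
    gcongr
    exact ENNReal.le_tsum (f := fun j => ψ (j + 1) ^ (1 / 2 : ℝ)) j
  have h2 : ∑' j, ψ (j + 1) ≠ ∞ := by
    refine ne_top_of_le_ne_top (ENNReal.mul_ne_top h1.ne h1.ne)
      ((ENNReal.tsum_le_tsum hj).trans ?_)
    rw [ENNReal.tsum_mul_left]
  exact ⟨ENNReal.ne_top_of_tsum_ne_top h2, ENNReal.summable_toReal h2⟩

end MixingInequality

namespace ConjugateProcess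

/-! ### First and second moments of the empirical distribution functions. -/

section Moments

variable {Ω : Type*} [mΩ : MeasurableSpace Ω] {P : Measure Ω}

theorem Xi_le (Z : ConjugateProcess P) : Z.Xi ≤ mΩ :=
  iSup_le fun s => (Z.measurable_ξ s).comap_le

theorem measurable_F_apply (Z : ConjugateProcess P) (t : ℕ) (x : ℝ) : Measurable (Z.F t x) :=
  (Z.measurable_F t).comp (measurable_const.prodMk measurable_id)

theorem measurable_real_Iic (x : ℝ) :
    Measurable fun ν : ProbabilityMeasure ℝ => (ν : Measure ℝ).real (Set.Iic x) :=
  ((Measure.measurable_coe measurableSet_Iic).comp measurable_subtype_coe).ennreal_toReal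

theorem integral_F_eq (Z : ConjugateProcess P) (t : ℕ) (x : ℝ) :
    ∫ ω, Z.F t x ω ∂P = ∫ ω, Z.F 0 x ω ∂P := by
  have h := ((Z.stationary t).comp
    (u := fun η : ℕ → ProbabilityMeasure ℝ => (η 0 : Measure ℝ).real (Set.Iic x))
    ((measurable_real_Iic x).comp (measurable_pi_apply 0))).integral_eq
  simpa [Function.comp_def, F] using h

theorem integral_F_mul_F_eq (Z : ConjugateProcess P) (t k : ℕ) (x y : ℝ) :
    ∫ ω, Z.F t x ω * Z.F (t + k) y ω ∂P = ∫ ω, Z.F 0 x ω * Z.F k y ω ∂P := by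
  have h := ((Z.stationary t).comp
    (u := fun η : ℕ → ProbabilityMeasure ℝ =>
      (η 0 : Measure ℝ).real (Set.Iic x) * (η k : Measure ℝ).real (Set.Iic y))
    (((measurable_real_Iic x).comp (measurable_pi_apply 0)).mul
      ((measurable_real_Iic y).comp (measurable_pi_apply k)))).integral_eq
  simpa [Function.comp_def, F, add_comm k t] using h

theorem measurableSet_X_le (Z : ConjugateProcess P) (τ : ℝ≥0) (x : ℝ) :
    MeasurableSet (Z.X τ ⁻¹' Set.Iic x) :=
  Z.measurable_X τ measurableSet_Iic

theorem Fhat_eq (Z : ConjugateProcess P) (S : SamplingScheme) (t : ℕ) (ω : Ω) (x : ℝ) :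
    Z.Fhat S t ω x = (1 / (S.q t : ℝ)) * ∑ i : Fin (S.q t),
      (Z.X (S.time t i) ⁻¹' Set.Iic x).indicator (fun _ => (1 : ℝ)) ω :=
  rfl

variable [IsProbabilityMeasure P]

theorem measureReal_X_le (Z : ConjugateProcess P) {t : ℕ} {τ : ℝ≥0} (h1 : (t : ℝ≥0) ≤ τ)
    (h2 : τ < (t : ℝ≥0) + 1) (x : ℝ) :
    P.real (Z.X τ ⁻¹' Set.Iic x) = ∫ ω, Z.F 0 x ω ∂P := by
  have h : P⟦Z.X τ ⁻¹' Set.Iic x | Z.Xi⟧ =ᵐ[P] Z.F t x :=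
    Z.compatible t τ h1 h2 _ measurableSet_Iic
  rw [← Z.integral_F_eq t, ← integral_congr_ae h,
    integral_condExp Z.Xi_le, integral_indicator_const _ (Z.measurableSet_X_le τ x), smul_eq_mul,
    mul_one]

/-- Given `Ξ`, the two events lie in distinct cycles because `k ≥ 1`, so their conditional
probability factors into `F_t(x) F_{t+k}(y)`; stationarity shifts its mean to cycle 0. -/
theorem measureReal_X_le_inter_X_le (Z : ConjugateProcess P) (hci : Z.CyclicIndependent)
    {t k : ℕ} (hk : 1 ≤ k) {τ σ : ℝ≥0} (h1 : (t : ℝ≥0) ≤ τ) (h2 : τ < (t : ℝ≥0) + 1)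
    (h3 : ((t + k : ℕ) : ℝ≥0) ≤ σ) (h4 : σ < ((t + k : ℕ) : ℝ≥0) + 1) (x y : ℝ) :
    P.real (Z.X τ ⁻¹' Set.Iic x ∩ Z.X σ ⁻¹' Set.Iic y)
      = ∫ ω, Z.F 0 x ω * Z.F k y ω ∂P := by
  have hne : t + k ≠ t := by omega
  set A := Z.X τ ⁻¹' Set.Iic x with hA
  set B := Z.X σ ⁻¹' Set.Iic y with hB
  have hAm : MeasurableSet[Z.cycleSigma t] A :=
    (le_iSup₂ (f := fun ρ (_ : ρ ∈ Set.Ico (t : ℝ≥0) (t + 1)) =>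
      MeasurableSpace.comap (Z.X ρ) inferInstance) τ ⟨h1, h2⟩) _ ⟨_, measurableSet_Iic, rfl⟩
  have hBm : MeasurableSet[Z.cycleSigma (t + k)] B :=
    (le_iSup₂ (f := fun ρ (_ : ρ ∈ Set.Ico ((t + k : ℕ) : ℝ≥0) ((t + k : ℕ) + 1)) =>
      MeasurableSpace.comap (Z.X ρ) inferInstance) σ ⟨h3, h4⟩) _ ⟨_, measurableSet_Iic, rfl⟩
  have h := hci {t, t + k} (fun u => if u = t then A else B) (by
    intro u hu
    simp only [Finset.mem_insert, Finset.mem_singleton] at hu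
    rcases hu with rfl | rfl
    · simpa using hAm
    · rw [if_neg hne]
      exact hBm)
  rw [Finset.prod_pair hne.symm, Finset.set_biInter_insert, Finset.set_biInter_singleton] at h
  simp only [if_true, if_neg hne] at h
  have h' : P⟦A ∩ B | Z.Xi⟧ =ᵐ[P] fun ω => Z.F t x ω * Z.F (t + k) y ω := by
    filter_upwards [h, Z.compatible t τ h1 h2 _ (measurableSet_Iic (a := x)),
      Z.compatible (t + k) σ h3 h4 _ (measurableSet_Iic (a := y))] with ω e1 e2 e3
    rw [e1, Pi.mul_apply, e2, e3]
    rfl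
  rw [← Z.integral_F_mul_F_eq t, ← integral_congr_ae h', integral_condExp Z.Xi_le,
    integral_indicator_const _ ((Z.measurableSet_X_le τ x).inter (Z.measurableSet_X_le σ y)),
    smul_eq_mul, mul_one]

theorem integral_Fhat (Z : ConjugateProcess P) (S : SamplingScheme) (t : ℕ) (x : ℝ) :
    ∫ ω, Z.Fhat S t ω x ∂P = ∫ ω, Z.F 0 x ω ∂P := by
  have hq : (S.q t : ℝ) ≠ 0 := by exact_mod_cast (S.q_pos t).ne'
  simp only [Fhat_eq]
  rw [integral_const_mul, integral_finsetSum _ fun i _ =>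
    (integrable_const (1 : ℝ)).indicator (Z.measurableSet_X_le _ x)]
  simp only [integral_indicator_const _ (Z.measurableSet_X_le _ x), smul_eq_mul, mul_one,
    Z.measureReal_X_le (S.le_time t _) (S.time_lt t _) x]
  simp
  field_simp

theorem integral_Fhat_mul_Fhat (Z : ConjugateProcess P) (hci : Z.CyclicIndependent)
    (S : SamplingScheme) (t : ℕ) {k : ℕ} (hk : 1 ≤ k) (x y : ℝ) :
    ∫ ω, Z.Fhat S t ω x * Z.Fhat S (t + k) ω y ∂P = ∫ ω, Z.F 0 x ω * Z.F k y ω ∂P := by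
  have hq : (S.q t : ℝ) ≠ 0 := by exact_mod_cast (S.q_pos t).ne'
  have hq' : (S.q (t + k) : ℝ) ≠ 0 := by exact_mod_cast (S.q_pos (t + k)).ne'
  have e : ∀ ω, Z.Fhat S t ω x * Z.Fhat S (t + k) ω y
      = (1 / (S.q t : ℝ)) * (1 / (S.q (t + k) : ℝ)) * ∑ i : Fin (S.q t),
        ∑ j : Fin (S.q (t + k)), (Z.X (S.time t i) ⁻¹' Set.Iic x ∩
          Z.X (S.time (t + k) j) ⁻¹' Set.Iic y).indicator (fun _ => (1 : ℝ)) ω := fun ω => by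
    rw [Fhat_eq, Fhat_eq, mul_mul_mul_comm, Finset.sum_mul_sum]
    simp only [← Set.inter_indicator_mul, mul_one]
  have hms : ∀ i j, MeasurableSet (Z.X (S.time t i) ⁻¹' Set.Iic x ∩
      Z.X (S.time (t + k) j) ⁻¹' Set.Iic y) := fun i j =>
    (Z.measurableSet_X_le _ x).inter (Z.measurableSet_X_le _ y)
  have hi : ∀ i j, Integrable ((Z.X (S.time t i) ⁻¹' Set.Iic x ∩
      Z.X (S.time (t + k) j) ⁻¹' Set.Iic y).indicator fun _ => (1 : ℝ)) P := fun i j =>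
    (integrable_const (1 : ℝ)).indicator (hms i j)
  simp only [e]
  rw [integral_const_mul, integral_finsetSum _ fun i _ => integrable_finsetSum _ fun j _ => hi i j]
  simp only [integral_finsetSum _ fun j _ => hi _ j, integral_indicator_const _ (hms _ _),
    smul_eq_mul, mul_one, Z.measureReal_X_le_inter_X_le hci hk (S.le_time t _) (S.time_lt t _)
      (S.le_time (t + k) _) (S.time_lt (t + k) _) x y]
  simp
  field_simp

theorem C_eq (Z : ConjugateProcess P) (k : ℕ) (x y : ℝ) :
    Z.C k x y = ∫ ω, Z.F 0 x ω * Z.F k y ω ∂P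
      - (∫ ω, Z.F 0 x ω ∂P) * ∫ ω, Z.F 0 y ω ∂P := by
  have hmem : ∀ t x, MemLp (Z.F t x) 2 P := fun t x =>
    MemLp.of_bound (Z.measurable_F_apply t x).aestronglyMeasurable 1
      (Eventually.of_forall fun ω => by
        rw [Real.norm_of_nonneg (Z.F_mem t x ω).1]; exact (Z.F_mem t x ω).2)
  rw [C, covariance_eq_sub (hmem 0 x) (hmem k y), Z.integral_F_eq k y]
  rfl

end Moments

/-! ### Recovering pointwise values of `F̂_t` from its class in `L²(μ)`. -/

section Measurability

variable {Ω : Type*} [mΩ : MeasurableSpace Ω] {P : Measure Ω}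

theorem measurable_Fhat_uncurry (Z : ConjugateProcess P) (S : SamplingScheme) (t : ℕ) :
    Measurable fun z : Ω × ℝ => Z.Fhat S t z.1 z.2 := by
  refine (Finset.measurable_fun_sum _ fun i _ => ?_).const_mul _
  have e : (fun z : Ω × ℝ => (Set.Iic z.2).indicator (1 : ℝ → ℝ) (Z.X (S.time t i) z.1))
      = {z : Ω × ℝ | Z.X (S.time t i) z.1 ≤ z.2}.indicator 1 := by
    funext z
    simp [Set.indicator_apply]
  rw [e]
  exact measurable_one.indicator
    (measurableSet_le ((Z.measurable_X _).comp measurable_fst) measurable_snd)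

theorem measurable_Fhat_apply (Z : ConjugateProcess P) (S : SamplingScheme) (t : ℕ) (x : ℝ) :
    Measurable fun ω => Z.Fhat S t ω x :=
  (Z.measurable_Fhat_uncurry S t).comp (measurable_id.prodMk measurable_const)

theorem measurable_Chat_uncurry (Z : ConjugateProcess P) (S : SamplingScheme) (p n k : ℕ) :
    Measurable fun w : Ω × ℝ × ℝ => Z.Chat S p n w.1 k w.2.1 w.2.2 := by
  have hx : Measurable fun w : Ω × ℝ × ℝ => (w.1, w.2.1) := by fun_prop
  have hy : Measurable fun w : Ω × ℝ × ℝ => (w.1, w.2.2) := by fun_prop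
  have hmean : Measurable fun z : Ω × ℝ => Z.meanHat S n z.1 z.2 :=
    (Finset.measurable_fun_sum _ fun t _ => Z.measurable_Fhat_uncurry S t).const_mul _
  exact (Finset.measurable_fun_sum _ fun t _ =>
    (((Z.measurable_Fhat_uncurry S t).comp hx).sub (hmean.comp hx)).mul
      (((Z.measurable_Fhat_uncurry S (t + k)).comp hy).sub (hmean.comp hy))).const_mul _

theorem eventually_Fhat_eq (Z : ConjugateProcess P) (S : SamplingScheme) (t : ℕ) (ω : Ω) (x : ℝ) :
    ∀ᶠ y in 𝓝[≥] x, Z.Fhat S t ω y = Z.Fhat S t ω x := by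
  have h : ∀ i : Fin (S.q t), ∀ᶠ y in 𝓝[≥] x,
      (Z.X (S.time t i) ω ≤ y ↔ Z.X (S.time t i) ω ≤ x) := by
    intro i
    rcases le_or_gt (Z.X (S.time t i) ω) x with hx | hx
    · filter_upwards [self_mem_nhdsWithin] with y hy
      exact iff_of_true (hx.trans hy) hx
    · filter_upwards [mem_nhdsWithin_of_mem_nhds (Iio_mem_nhds hx)] with y hy
      exact iff_of_false (not_le.2 hy) (not_le.2 hx)
  filter_upwards [eventually_all.2 h] with y hy
  simp [Fhat, Set.indicator_apply, hy]

/-- The value at `x` is the limit of `μ`-averages over `[x, x + 1/(m+1)]`, which are continuous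
functionals on `L²(μ)`. Right-continuity gives the limit, and `hx` makes the averages meaningful. -/
theorem measurable_comap_FhatLp (Z : ConjugateProcess P) (S : SamplingScheme) {μ : Measure ℝ}
    [IsFiniteMeasure μ] {x : ℝ} (hx : ∀ h > 0, 0 < μ (Set.Icc x (x + h))) (t : ℕ) :
    Measurable[MeasurableSpace.comap (Z.FhatLp S μ t) (borel _)] fun ω => Z.Fhat S t ω x := by
  let I : ℕ → Set ℝ := fun m => Set.Icc x (x + 1 / ((m : ℝ) + 1))
  have hI0 : ∀ m, μ.real (I m) ≠ 0 := fun m =>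
    (ENNReal.toReal_pos (hx _ Nat.one_div_pos_of_nat).ne' (measure_ne_top _ _)).ne'
  refine @measurable_of_tendsto_metrizable _ _
    (MeasurableSpace.comap (Z.FhatLp S μ t) (borel _)) _ _ _ _
    (fun m ω => (μ.real (I m))⁻¹ * ∫ z in I m, Z.Fhat S t ω z ∂μ) _ ?_ ?_
  · intro m
    let g : Lp ℝ 2 μ → ℝ := fun f =>
      (μ.real (I m))⁻¹ * inner ℝ (indicatorConstLp 2 measurableSet_Icc (measure_ne_top μ (I m)) (1 : ℝ)) f
    have hg : Continuous g := by fun_prop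
    have hgm : Measurable[borel _] g := by
      borelize ↥(Lp ℝ 2 μ)
      exact hg.measurable
    have e : (fun ω => (μ.real (I m))⁻¹ * ∫ z in I m, Z.Fhat S t ω z ∂μ)
        = g ∘ Z.FhatLp S μ t := by
      funext ω
      simp only [g, Function.comp_apply]
      rw [L2.inner_indicatorConstLp_one]
      congr 1
      refine integral_congr_ae (ae_restrict_of_ae ?_)
      exact (Z.memLp_Fhat S μ t ω).coeFn_toLp.symm
    rw [e]
    exact hgm.comp (comap_measurable _)
  · rw [tendsto_pi_nhds]
    intro ω
    obtain ⟨u, hu, hIu⟩ := (mem_nhdsGE_iff_exists_Icc_subset.1 (Z.eventually_Fhat_eq S t ω x))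
    refine tendsto_const_nhds.congr' ?_
    have hlim : Tendsto (fun m : ℕ => x + 1 / ((m : ℝ) + 1)) atTop (𝓝 x) := by
      simpa using tendsto_one_div_add_atTop_nhds_zero_nat.const_add x
    filter_upwards [hlim.eventually (Iio_mem_nhds hu)] with m hm
    have : ∫ z in I m, Z.Fhat S t ω z ∂μ = ∫ z in I m, Z.Fhat S t ω x ∂μ :=
      setIntegral_congr_fun measurableSet_Icc fun z hz => hIu ⟨hz.1, hz.2.trans (le_of_lt hm)⟩
    rw [this, setIntegral_const, smul_eq_mul, inv_mul_cancel_left₀ (hI0 m)]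

/-- Only a greatest element of the interval can fail, and a single point is Lebesgue-null, hence
`μ`-null. -/
theorem ae_forall_pos_measure_Icc {Z : ConjugateProcess P} {μ : Measure ℝ}
    (hμ : Z.IsDiffraction μ) : ∀ᵐ x ∂μ, ∀ h > 0, 0 < μ (Set.Icc x (x + h)) := by
  obtain ⟨I, hI, -, h1, h2⟩ := hμ
  refine h1.ae_le ((ae_restrict_iff' hI.measurableSet).2 ?_)
  have hsub : {x ∈ I | ∀ y ∈ I, y ≤ x}.Subsingleton := fun x hx y hy =>
    le_antisymm (hy.2 x hx.1) (hx.2 y hy.1)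
  have hnull : ∀ᵐ x ∂(volume : Measure ℝ), x ∉ {x ∈ I | ∀ y ∈ I, y ≤ x} :=
    measure_eq_zero_iff_ae_notMem.1 (hsub.measure_zero volume)
  filter_upwards [hnull] with x hx hxI h hh
  have : ∃ y ∈ I, x < y := by
    by_contra! hcon
    exact hx ⟨hxI, hcon⟩
  obtain ⟨y, hyI, hxy⟩ := this
  have hlt : x < min y (x + h) := lt_min hxy (by linarith)
  have hpos : volume.restrict I (Set.Icc x (min y (x + h))) ≠ 0 := by
    rw [Measure.restrict_apply measurableSet_Icc, Set.inter_eq_left.2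
      ((Set.Icc_subset_Icc_right (min_le_left _ _)).trans (hI.out hxI hyI)), Real.volume_Icc]
    simpa using hlt
  exact (pos_iff_ne_zero.2 fun h0 => hpos (h2 h0)).trans_le
    (measure_mono (Set.Icc_subset_Icc_right (min_le_right _ _)))

end Measurability

/-! ### Mean squared error of the estimated covariances. -/

section Estimation

variable {Ω : Type*} [mΩ : MeasurableSpace Ω] {P : Measure Ω}
  (Z : ConjugateProcess P) (S : SamplingScheme)

/-- The centred empirical distribution function `F̂_t(x) - 𝔼 F_0(x)`. -/
noncomputable def FhatCentered (x : ℝ) (t : ℕ) (ω : Ω) : ℝ :=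
  Z.Fhat S t ω x - ∫ ω, Z.F 0 x ω ∂P

theorem measurable_FhatCentered (x : ℝ) (t : ℕ) : Measurable (Z.FhatCentered S x t) :=
  (Z.measurable_Fhat_apply S t x).sub_const _

theorem meanHat_sub_eq {n : ℕ} (hn : 0 < n) (x : ℝ) (ω : Ω) :
    Z.meanHat S n ω x - ∫ ω, Z.F 0 x ω ∂P
      = (1 / (n : ℝ)) * ∑ t ∈ Finset.Icc 1 n, Z.FhatCentered S x t ω := by
  have hn' : (n : ℝ) ≠ 0 := by exact_mod_cast hn.ne'
  simp only [FhatCentered, meanHat, Finset.sum_sub_distrib, Finset.sum_const, Nat.card_Icc,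
    Nat.add_sub_cancel, nsmul_eq_mul]
  field_simp

/-- The squared Hilbert–Schmidt distance `∑_{k=1}^p ‖Ĉ_k - C_k‖²` in `L²(μ ⊗ μ)`. -/
noncomputable def covError (μ : Measure ℝ) (p n : ℕ) (ω : Ω) : ℝ :=
  ∑ k ∈ Finset.Icc 1 p, ∫ z, (Z.Chat S p n ω k z.1 z.2 - Z.C k z.1 z.2) ^ 2 ∂μ.prod μ

theorem covError_nonneg (μ : Measure ℝ) (p n : ℕ) (ω : Ω) : 0 ≤ Z.covError S μ p n ω :=
  Finset.sum_nonneg fun _ _ => integral_nonneg fun _ => sq_nonneg _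

theorem measurable_sigmaOf_FhatCentered (μ : Measure ℝ) [IsFiniteMeasure μ] {x : ℝ} (hx : ∀ h > 0, 0 < μ (Set.Icc x (x + h)))
    {t : ℕ} {s : Set ℕ} (ht : t ∈ s) :
    Measurable[sigmaOf (Z.FhatLp S μ) s] (Z.FhatCentered S x t) := by
  have h : MeasurableSpace.comap (Z.FhatLp S μ t) (borel _) ≤ sigmaOf (Z.FhatLp S μ) s :=
    le_iSup₂ (f := fun u (_ : u ∈ s) => MeasurableSpace.comap (Z.FhatLp S μ u) (borel _)) t ht
  exact ((Z.measurable_comap_FhatLp S hx t).mono h le_rfl).sub_const _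

/-- The constant in the bound for the mean squared error of `Ĉ_k(x, y)`. -/
noncomputable def mseConst (μ : Measure ℝ) [IsFiniteMeasure μ] (p : ℕ) : ℝ :=
  16 * ∑ k ∈ Finset.Icc 1 p, ∑' j, lagBound (psiMixingCoeff P (Z.FhatLp S μ)) k j
    + 24 * ∑' j, lagBound (psiMixingCoeff P (Z.FhatLp S μ)) 0 j

variable [IsProbabilityMeasure P]

theorem integral_F_mem (t : ℕ) (x : ℝ) :
    0 ≤ (∫ ω, Z.F t x ω ∂P) ∧ (∫ ω, Z.F t x ω ∂P) ≤ 1 := by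
  refine ⟨integral_nonneg fun ω => (Z.F_mem t x ω).1, ?_⟩
  have h := norm_integral_le_of_norm_le_const (μ := P) (f := fun ω => Z.F t x ω) (C := 1)
    (Eventually.of_forall fun ω => by
      rw [Real.norm_of_nonneg (Z.F_mem t x ω).1]; exact (Z.F_mem t x ω).2)
  rw [probReal_univ, mul_one] at h
  exact (le_abs_self _).trans h

theorem abs_FhatCentered_le (x : ℝ) (t : ℕ) (ω : Ω) : |Z.FhatCentered S x t ω| ≤ 1 := by
  rw [FhatCentered, abs_le]
  constructor <;> linarith [(Z.Fhat_mem S t ω x).1, (Z.Fhat_mem S t ω x).2,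
    (Z.integral_F_mem 0 x).1, (Z.integral_F_mem 0 x).2]

theorem integrable_Fhat (x : ℝ) (t : ℕ) : Integrable (fun ω => Z.Fhat S t ω x) P :=
  Integrable.of_bound (Z.measurable_Fhat_apply S t x).aestronglyMeasurable 1
    (Eventually.of_forall fun ω => by
      rw [Real.norm_of_nonneg (Z.Fhat_mem S t ω x).1]; exact (Z.Fhat_mem S t ω x).2)

theorem integral_FhatCentered (x : ℝ) (t : ℕ) : ∫ ω, Z.FhatCentered S x t ω ∂P = 0 := by
  unfold FhatCentered
  rw [integral_sub (Z.integrable_Fhat S x t) (integrable_const _), Z.integral_Fhat]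
  simp

theorem integral_FhatCentered_mul (hci : Z.CyclicIndependent) (x y : ℝ) (t : ℕ) {k : ℕ}
    (hk : 1 ≤ k) :
    ∫ ω, Z.FhatCentered S x t ω * Z.FhatCentered S y (t + k) ω ∂P = Z.C k x y := by
  have i1 : Integrable (fun ω => Z.Fhat S t ω x * Z.Fhat S (t + k) ω y) P :=
    (Z.integrable_Fhat S y (t + k)).bdd_mul (c := 1)
      (Z.measurable_Fhat_apply S t x).aestronglyMeasurable (Eventually.of_forall fun ω => by
        rw [Real.norm_of_nonneg (Z.Fhat_mem S t ω x).1]; exact (Z.Fhat_mem S t ω x).2)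
  have e : ∀ ω, Z.FhatCentered S x t ω * Z.FhatCentered S y (t + k) ω
      = Z.Fhat S t ω x * Z.Fhat S (t + k) ω y
        - ((∫ ω, Z.F 0 x ω ∂P) * Z.Fhat S (t + k) ω y
          + (∫ ω, Z.F 0 y ω ∂P) * Z.FhatCentered S x t ω) := fun ω => by
    unfold FhatCentered
    ring
  have i2 : Integrable (fun ω => (∫ ω, Z.F 0 x ω ∂P) * Z.Fhat S (t + k) ω y) P :=
    (Z.integrable_Fhat S y (t + k)).const_mul _
  have i3 : Integrable (fun ω => (∫ ω, Z.F 0 y ω ∂P) * Z.FhatCentered S x t ω) P :=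
    ((Z.integrable_Fhat S x t).sub (integrable_const _)).const_mul _
  simp only [e]
  have i23 : Integrable (fun ω => (∫ ω, Z.F 0 x ω ∂P) * Z.Fhat S (t + k) ω y
      + (∫ ω, Z.F 0 y ω ∂P) * Z.FhatCentered S x t ω) P := i2.add i3
  rw [integral_sub i1 i23, integral_add i2 i3, integral_const_mul, integral_const_mul,
    Z.integral_FhatCentered, Z.integral_Fhat_mul_Fhat hci S t hk, Z.integral_Fhat, Z.C_eq]
  ring

/-- With `α`, `β` the errors of the estimated mean at `x` and `y`, centring produces the main
average `a` and three remainders, each a product of `α` or `β` with a factor bounded by 1. Two of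
them are charged to `β`, whence the inner 2; the 4 is Cauchy–Schwarz for four terms. -/
theorem Chat_sub_C_sq_le {p n : ℕ} (hpn : p < n) (k : ℕ) (x y : ℝ) (ω : Ω) :
    (Z.Chat S p n ω k x y - Z.C k x y) ^ 2
      ≤ 4 * ((1 / ((n : ℝ) - p)) ^ 2 * (∑ t ∈ Finset.Icc 1 (n - p),
            (Z.FhatCentered S x t ω * Z.FhatCentered S y (t + k) ω - Z.C k x y)) ^ 2
          + (1 / (n : ℝ)) ^ 2 * (∑ t ∈ Finset.Icc 1 n, Z.FhatCentered S x t ω) ^ 2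
          + 2 * ((1 / (n : ℝ)) ^ 2 * (∑ t ∈ Finset.Icc 1 n, Z.FhatCentered S y t ω) ^ 2)) := by
  have hn : 0 < n := by omega
  have hN : (0 : ℝ) < (n : ℝ) - p := by
    have : (p : ℝ) < n := by exact_mod_cast hpn
    linarith
  set α := Z.meanHat S n ω x - ∫ ω, Z.F 0 x ω ∂P with hα
  set β := Z.meanHat S n ω y - ∫ ω, Z.F 0 y ω ∂P with hβ
  have hβ1 : |β| ≤ 1 := by
    rw [hβ, abs_le]
    constructor <;> linarith [(Z.meanHat_mem S n ω y).1, (Z.meanHat_mem S n ω y).2,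
      (Z.integral_F_mem 0 y).1, (Z.integral_F_mem 0 y).2]
  have hα1 : |α| ≤ 1 := by
    rw [hα, abs_le]
    constructor <;> linarith [(Z.meanHat_mem S n ω x).1, (Z.meanHat_mem S n ω x).2,
      (Z.integral_F_mem 0 x).1, (Z.integral_F_mem 0 x).2]
  have havg : ∀ u : ℕ → ℝ, (∀ t, |u t| ≤ 1) →
      |1 / ((n : ℝ) - p) * ∑ t ∈ Finset.Icc 1 (n - p), u t| ≤ 1 := by
    intro u hu
    have h2 : |∑ t ∈ Finset.Icc 1 (n - p), u t| ≤ (n : ℝ) - p := by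
      refine (Finset.abs_sum_le_sum_abs _ _).trans
        ((Finset.sum_le_sum (g := fun _ => (1 : ℝ)) fun t _ => hu t).trans ?_)
      simp [Nat.cast_sub hpn.le]
    rw [abs_mul, abs_of_pos (one_div_pos.2 hN), one_div, inv_mul_le_iff₀ hN, mul_one]
    exact h2
  set A := 1 / ((n : ℝ) - p) * ∑ t ∈ Finset.Icc 1 (n - p), Z.FhatCentered S y (t + k) ω with hA
  set B := 1 / ((n : ℝ) - p) * ∑ t ∈ Finset.Icc 1 (n - p), Z.FhatCentered S x t ω with hB
  have hA1 : |A| ≤ 1 := havg _ fun t => Z.abs_FhatCentered_le S y (t + k) ω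
  have hB1 : |B| ≤ 1 := havg _ fun t => Z.abs_FhatCentered_le S x t ω
  set a := 1 / ((n : ℝ) - p) * ∑ t ∈ Finset.Icc 1 (n - p),
    (Z.FhatCentered S x t ω * Z.FhatCentered S y (t + k) ω - Z.C k x y) with ha
  have hdec : Z.Chat S p n ω k x y - Z.C k x y = a - α * A - B * β + α * β := by
    have e : ∀ t, (Z.Fhat S t ω x - Z.meanHat S n ω x) * (Z.Fhat S (t + k) ω y - Z.meanHat S n ω y)
        = (Z.FhatCentered S x t ω * Z.FhatCentered S y (t + k) ω - Z.C k x y)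
          - α * Z.FhatCentered S y (t + k) ω - Z.FhatCentered S x t ω * β
          + (α * β + Z.C k x y) := fun t => by
      simp only [FhatCentered, hα, hβ]
      ring
    simp only [Chat, e]
    rw [Finset.sum_add_distrib, Finset.sum_sub_distrib, Finset.sum_sub_distrib, ← Finset.mul_sum,
      ← Finset.sum_mul, Finset.sum_const, Nat.card_Icc, Nat.add_sub_cancel, nsmul_eq_mul,
      Nat.cast_sub hpn.le, ha, hA, hB]
    field_simp
    ring
  rw [hdec, ← mul_pow, ← mul_pow, ← mul_pow, ← ha, ← Z.meanHat_sub_eq S hn x ω,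
    ← Z.meanHat_sub_eq S hn y ω, ← hα, ← hβ]
  have h1 : (α * A) ^ 2 ≤ α ^ 2 := by
    rw [mul_pow]
    exact mul_le_of_le_one_right (sq_nonneg _) ((sq_le_one_iff_abs_le_one A).2 hA1)
  have h2 : (B * β) ^ 2 ≤ β ^ 2 := by
    rw [mul_pow]
    exact mul_le_of_le_one_left (sq_nonneg _) ((sq_le_one_iff_abs_le_one B).2 hB1)
  have h3 : (α * β) ^ 2 ≤ β ^ 2 := by
    rw [mul_pow]
    exact mul_le_of_le_one_left (sq_nonneg _) ((sq_le_one_iff_abs_le_one α).2 hα1)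
  have h4 : ∀ a b c d : ℝ, (a - b - c + d) ^ 2 ≤ 4 * (a ^ 2 + b ^ 2 + c ^ 2 + d ^ 2) := by
    intro a b c d
    linarith [sq_nonneg (a + b), sq_nonneg (a + c), sq_nonneg (a - d), sq_nonneg (b - c),
      sq_nonneg (b + d), sq_nonneg (c + d)]
  linarith [h4 a (α * A) (B * β) (α * β)]

variable {μ : Measure ℝ} [IsFiniteMeasure μ]

theorem integral_Chat_sub_C_sq_le (hci : Z.CyclicIndependent)
    (hfin : ∀ j, psiMixingCoeff P (Z.FhatLp S μ) (j + 1) ≠ ∞)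
    (hsum : Summable fun j => (psiMixingCoeff P (Z.FhatLp S μ) (j + 1)).toReal)
    {p n k : ℕ} (hn : 0 < n) (hpn : 2 * p ≤ n) (hk : k ∈ Finset.Icc 1 p) {x y : ℝ}
    (hx : ∀ h > 0, 0 < μ (Set.Icc x (x + h))) (hy : ∀ h > 0, 0 < μ (Set.Icc y (y + h))) :
    ∫ ω, (Z.Chat S p n ω k x y - Z.C k x y) ^ 2 ∂P ≤ Z.mseConst S μ p / n := by
  have hk1 := (Finset.mem_Icc.1 hk).1
  have hpn' : p < n := by omega
  have hnpos : (0 : ℝ) < n := by exact_mod_cast hn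
  -- This is why `2 * p ≤ n` is required: `1/(n - p)` becomes at most `2/n`.
  have hN : (n : ℝ) / 2 ≤ (n : ℝ) - p := by
    have : (2 : ℝ) * p ≤ n := by exact_mod_cast hpn
    linarith
  set b : ℕ → ℝ := fun k => ∑' j, lagBound (psiMixingCoeff P (Z.FhatLp S μ)) k j with hb
  have hb0 : ∀ k, 0 ≤ b k := fun k => tsum_nonneg fun j => lagBound_nonneg _ k j
  let H : ℕ → Ω → ℝ := fun t ω =>
    Z.FhatCentered S x t ω * Z.FhatCentered S y (t + k) ω - Z.C k x y
  have hGG : ∀ t ω, |Z.FhatCentered S x t ω * Z.FhatCentered S y (t + k) ω| ≤ 1 := fun t ω => by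
    rw [abs_mul]
    exact mul_le_one₀ (Z.abs_FhatCentered_le S x t ω) (abs_nonneg _)
      (Z.abs_FhatCentered_le S y (t + k) ω)
  have hHm : ∀ t, Measurable (H t) := fun t =>
    ((Z.measurable_FhatCentered S x t).mul (Z.measurable_FhatCentered S y (t + k))).sub_const _
  have hH2 : ∀ t ω, |H t ω| ≤ 2 := fun t ω =>
    (abs_sub _ _).trans (by linarith [hGG t ω, Z.abs_C_le k x y])
  have hT1 : ∫ ω, (∑ t ∈ Finset.Icc 1 (n - p), H t ω) ^ 2 ∂P ≤ 2 * (n - p : ℕ) * b k := by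
    refine integral_sum_sq_le_of_mixing hfin hsum k hHm (fun t => ?_) hH2 (fun t => ?_) _
    · exact ((Z.measurable_sigmaOf_FhatCentered S μ hx (by simp)).mul
        (Z.measurable_sigmaOf_FhatCentered S μ hy (by simp))).sub_const _
    · simp only [H]
      have hi : Integrable (fun ω => Z.FhatCentered S x t ω * Z.FhatCentered S y (t + k) ω) P :=
        Integrable.of_bound ((Z.measurable_FhatCentered S x t).mul
          (Z.measurable_FhatCentered S y (t + k))).aestronglyMeasurable 1
          (Eventually.of_forall (hGG t))
      rw [integral_sub hi (integrable_const _),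
        Z.integral_FhatCentered_mul S hci x y t hk1]
      simp
  have hT2 : ∀ u : ℝ, (∀ h > 0, 0 < μ (Set.Icc u (u + h))) →
      ∫ ω, (∑ t ∈ Finset.Icc 1 n, Z.FhatCentered S u t ω) ^ 2 ∂P ≤ 2 * n * b 0 := fun u hu =>
    integral_sum_sq_le_of_mixing hfin hsum 0 (Z.measurable_FhatCentered S u)
      (fun t => Z.measurable_sigmaOf_FhatCentered S μ hu (by simp))
      (fun t ω => (Z.abs_FhatCentered_le S u t ω).trans one_le_two)
      (Z.integral_FhatCentered S u) n
  have hsqint : ∀ (N : ℕ) (G : ℕ → Ω → ℝ), (∀ t, Measurable (G t)) → (∀ t ω, |G t ω| ≤ 2) →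
      Integrable (fun ω => (∑ t ∈ Finset.Icc 1 N, G t ω) ^ 2) P := by
    intro N G hG hG2
    refine Integrable.of_bound
      ((Finset.measurable_fun_sum _ fun t _ => hG t).pow_const 2).aestronglyMeasurable
      ((2 * N : ℝ) ^ 2) (Eventually.of_forall fun ω => ?_)
    rw [norm_pow, Real.norm_eq_abs]
    refine pow_le_pow_left₀ (abs_nonneg _) ?_ 2
    refine (Finset.abs_sum_le_sum_abs _ _).trans ((Finset.sum_le_sum fun t _ => hG2 t ω).trans ?_)
    simp [mul_comm]
  have i1 := (hsqint (n - p) H hHm hH2).const_mul ((1 / ((n : ℝ) - p)) ^ 2)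
  have i2 : ∀ u, Integrable (fun ω => (1 / (n : ℝ)) ^ 2 *
      (∑ t ∈ Finset.Icc 1 n, Z.FhatCentered S u t ω) ^ 2) P := fun u =>
    (hsqint n (Z.FhatCentered S u) (Z.measurable_FhatCentered S u)
      (fun t ω => (Z.abs_FhatCentered_le S u t ω).trans one_le_two)).const_mul _
  have i12 := i1.add (i2 x)
  have i3 := (i2 y).const_mul 2
  have hmono := integral_mono_of_nonneg (μ := P) (Eventually.of_forall fun ω => sq_nonneg _)
    ((i12.add i3).const_mul 4)
    (Eventually.of_forall fun ω => Z.Chat_sub_C_sq_le S hpn' k x y ω)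
  refine hmono.trans ?_
  rw [integral_const_mul, integral_add' i12 i3, integral_add' i1 (i2 x), integral_const_mul,
    integral_const_mul, integral_const_mul, integral_const_mul]
  have hbk : b k ≤ ∑ k ∈ Finset.Icc 1 p, b k :=
    Finset.single_le_sum (fun k _ => hb0 k) hk
  have e1 : (1 / ((n : ℝ) - p)) ^ 2 * ∫ ω, (∑ t ∈ Finset.Icc 1 (n - p), H t ω) ^ 2 ∂P
      ≤ 4 * b k / n := by
    have hNpos : 0 < (n : ℝ) - p := by linarith
    refine (mul_le_mul_of_nonneg_left hT1 (sq_nonneg _)).trans ?_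
    rw [Nat.cast_sub hpn'.le]
    have : (1 / ((n : ℝ) - p)) ^ 2 * (2 * ((n : ℝ) - p) * b k) = 2 * b k / ((n : ℝ) - p) := by
      field_simp
    rw [this, div_le_div_iff₀ hNpos hnpos]
    nlinarith [hb0 k]
  have e2 : ∀ u : ℝ, (∀ h > 0, 0 < μ (Set.Icc u (u + h))) → (1 / (n : ℝ)) ^ 2 *
      ∫ ω, (∑ t ∈ Finset.Icc 1 n, Z.FhatCentered S u t ω) ^ 2 ∂P ≤ 2 * b 0 / n := fun u hu => by
    refine (mul_le_mul_of_nonneg_left (hT2 u hu) (sq_nonneg _)).trans (le_of_eq ?_)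
    field_simp
  have e3 : Z.mseConst S μ p / n = 16 * (∑ k ∈ Finset.Icc 1 p, b k) / n + 24 * b 0 / n := by
    rw [mseConst, add_div]
  -- The 16 and 24 of `mseConst` arise here, as `4 · 4` and `4 · (2 + 4)`.
  have e4 : 4 * (4 * b k / n + 2 * b 0 / n + 2 * (2 * b 0 / n)) ≤ Z.mseConst S μ p / n := by
    rw [e3]
    have : 4 * (4 * b k / n + 2 * b 0 / n + 2 * (2 * b 0 / n)) = 16 * b k / n + 24 * b 0 / n := by
      ring
    rw [this]
    gcongr
  linarith [e2 x hx, e2 y hy]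

theorem integrable_Chat_sub_C_sq (p n k : ℕ) :
    Integrable (Function.uncurry fun (ω : Ω) (z : ℝ × ℝ) =>
      (Z.Chat S p n ω k z.1 z.2 - Z.C k z.1 z.2) ^ 2) (P.prod (μ.prod μ)) := by
  refine Integrable.of_bound (((Z.measurable_Chat_uncurry S p n k).sub
    ((Z.measurable_C k).comp measurable_snd)).pow_const 2).aestronglyMeasurable 4
    (Eventually.of_forall fun w => ?_)
  have h : |Z.Chat S p n w.1 k w.2.1 w.2.2 - Z.C k w.2.1 w.2.2| ≤ 2 :=
    (abs_sub _ _).trans (by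
      linarith [Z.abs_Chat_le S p n w.1 k w.2.1 w.2.2, Z.abs_C_le k w.2.1 w.2.2])
  change ‖(Z.Chat S p n w.1 k w.2.1 w.2.2 - Z.C k w.2.1 w.2.2) ^ 2‖ ≤ 4
  rw [norm_pow, Real.norm_eq_abs]
  exact (pow_le_pow_left₀ (abs_nonneg _) h 2).trans (by norm_num)

theorem integrable_covError (p n : ℕ) : Integrable (Z.covError S μ p n) P :=
  integrable_finsetSum _ fun k _ => (Z.integrable_Chat_sub_C_sq S p n k).integral_prod_left

/-- Fubini moves the expectation inside, and the pointwise bound holds at `μ ⊗ μ`-almost every `(x,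
y)`. -/
theorem integral_covError_le (hci : Z.CyclicIndependent) (hμ : Z.IsDiffraction μ)
    (hfin : ∀ j, psiMixingCoeff P (Z.FhatLp S μ) (j + 1) ≠ ∞)
    (hsum : Summable fun j => (psiMixingCoeff P (Z.FhatLp S μ) (j + 1)).toReal)
    {p n : ℕ} (hn : 0 < n) (hpn : 2 * p ≤ n) :
    ∫ ω, Z.covError S μ p n ω ∂P
      ≤ p * (μ.prod μ).real Set.univ * Z.mseConst S μ p / n := by
  have hint : ∀ k, Integrable (fun ω =>
      ∫ z, (Z.Chat S p n ω k z.1 z.2 - Z.C k z.1 z.2) ^ 2 ∂μ.prod μ) P := fun k =>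
    (Z.integrable_Chat_sub_C_sq S p n k).integral_prod_left
  unfold covError
  rw [integral_finsetSum _ fun k _ => hint k]
  have hgood := ae_forall_pos_measure_Icc hμ
  have hgood2 : ∀ᵐ z ∂μ.prod μ, (∀ h > 0, 0 < μ (Set.Icc z.1 (z.1 + h))) ∧
      ∀ h > 0, 0 < μ (Set.Icc z.2 (z.2 + h)) :=
    (Measure.quasiMeasurePreserving_fst.ae hgood).and
      (Measure.quasiMeasurePreserving_snd.ae hgood)
  have hterm : ∀ k ∈ Finset.Icc 1 p,
      ∫ ω, ∫ z, (Z.Chat S p n ω k z.1 z.2 - Z.C k z.1 z.2) ^ 2 ∂μ.prod μ ∂P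
        ≤ (μ.prod μ).real Set.univ * (Z.mseConst S μ p / n) := by
    intro k hk
    rw [integral_integral_swap (Z.integrable_Chat_sub_C_sq S p n k)]
    have hi : Integrable (fun z : ℝ × ℝ =>
        ∫ ω, (Z.Chat S p n ω k z.1 z.2 - Z.C k z.1 z.2) ^ 2 ∂P) (μ.prod μ) :=
      (Z.integrable_Chat_sub_C_sq S p n k).integral_prod_right
    have hle : ∀ᵐ z ∂μ.prod μ, ∫ ω, (Z.Chat S p n ω k z.1 z.2 - Z.C k z.1 z.2) ^ 2 ∂P
        ≤ Z.mseConst S μ p / n := by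
      filter_upwards [hgood2] with z hz
      exact Z.integral_Chat_sub_C_sq_le S hci hfin hsum hn hpn hk hz.1 hz.2
    refine (integral_mono_ae hi (integrable_const _) hle).trans (le_of_eq ?_)
    rw [integral_const, smul_eq_mul]
  refine (Finset.sum_le_sum hterm).trans (le_of_eq ?_)
  simp only [Finset.sum_const, Nat.card_Icc, Nat.add_sub_cancel, nsmul_eq_mul]
  ring

end Estimation

/-! ### From the covariance error to the estimated dimension. -/

section Operators

variable {Ω : Type*} [mΩ : MeasurableSpace Ω] {P : Measure Ω}
  (Z : ConjugateProcess P) (S : SamplingScheme) (μ : Measure ℝ) [IsFiniteMeasure μ]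

open scoped InnerProductSpace

/-- Expanding the factor `Ĉ_k(x, z)` over cycles makes the kernel separable, with one term for each
pair `(k, t)`; for `n ≤ p` there are none and the operator vanishes. -/
theorem finiteDimensional_range_RhatOp (p n : ℕ) (ω : Ω) :
    FiniteDimensional ℝ (LinearMap.range (Z.RhatOp S μ p n ω)) := by
  let v : ℕ → ℝ → ℝ := fun t x => Z.Fhat S t ω x - Z.meanHat S n ω x
  have hvm : ∀ t, Measurable (v t) := fun t =>
    (Z.measurable_Fhat S t ω).sub (Z.measurable_meanHat S n ω)
  have hv1 : ∀ t x, |v t x| ≤ 1 := fun t x => by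
    simp only [v, abs_le]
    constructor <;> linarith [(Z.Fhat_mem S t ω x).1, (Z.Fhat_mem S t ω x).2,
      (Z.meanHat_mem S n ω x).1, (Z.meanHat_mem S n ω x).2]
  let w : ℕ × ℕ → ℝ → ℝ := fun i y =>
    1 / ((n : ℝ) - p) * ∫ z, v (i.2 + i.1) z * Z.Chat S p n ω i.1 y z ∂μ
  have hwm : ∀ i, Measurable (w i) := fun i => by
    have h : Measurable fun z : ℝ × ℝ => v (i.2 + i.1) z.2 * Z.Chat S p n ω i.1 z.1 z.2 :=
      ((hvm _).comp measurable_snd).mul (Z.measurable_Chat S p n ω i.1)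
    exact (h.stronglyMeasurable.integral_prod_right' (ν := μ)).measurable.const_mul _
  have hvC : ∀ t k y z, ‖v t z * Z.Chat S p n ω k y z‖ ≤ 1 := fun t k y z => by
    rw [Real.norm_eq_abs, abs_mul]
    exact mul_le_one₀ (hv1 _ _) (abs_nonneg _) (Z.abs_Chat_le S p n ω _ y z)
  have hint : ∀ t k y, Integrable (fun z => v t z * Z.Chat S p n ω k y z) μ := fun t k y =>
    Integrable.of_bound ((hvm t).mul
      (Z.measurable_Chat S p n ω k).of_uncurry_left).aestronglyMeasurable 1
      (Eventually.of_forall (hvC t k y))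
  refine finiteDimensional_range_integralOp (Finset.Icc 1 p ×ˢ Finset.Icc 1 (n - p))
    (u := fun i => v i.2) (w := w)
    (fun i => MemLp.of_bound (hvm _).aestronglyMeasurable 1 (Eventually.of_forall (hv1 _)))
    (fun i => MemLp.of_bound (hwm i).aestronglyMeasurable
      (|1 / ((n : ℝ) - p)| * (1 * μ.real Set.univ)) (Eventually.of_forall fun y => ?_)) _
    fun x y => ?_
  · rw [norm_mul, Real.norm_eq_abs]
    gcongr
    exact norm_integral_le_of_norm_le_const (Eventually.of_forall (hvC _ _ y))
  · rw [sumSqKernel, Finset.sum_product]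
    refine Finset.sum_congr rfl fun k _ => ?_
    have e : ∀ z, Z.Chat S p n ω k x z * Z.Chat S p n ω k y z
        = ∑ t ∈ Finset.Icc 1 (n - p),
          v t x * (1 / ((n : ℝ) - p)) * (v (t + k) z * Z.Chat S p n ω k y z) := fun z => by
      rw [Chat, Finset.mul_sum, Finset.sum_mul]
      exact Finset.sum_congr rfl fun t _ => by
        simp only [v]
        ring
    simp only [e]
    rw [integral_finsetSum _ fun t _ => (hint (t + k) k y).const_mul _]
    refine Finset.sum_congr rfl fun t _ => ?_
    rw [integral_const_mul, mul_assoc]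

theorem isSymmetric_RhatOp (p n : ℕ) (ω : Ω) : (Z.RhatOp S μ p n ω).IsSymmetric :=
  isSymmetric_integralOp_sumSqKernel (Z.measurable_Chat S p n ω) (Z.abs_Chat_le S p n ω) p _

theorem exists_form_bound_RhatOp (p n : ℕ) (ω : Ω) :
    ∃ M, 0 ≤ M ∧ ∀ f, |⟪Z.RhatOp S μ p n ω f, f⟫_ℝ| ≤ M * ‖f‖ ^ 2 := by
  refine ⟨√(∫ z, Function.uncurry (sumSqKernel μ p (Z.Chat S p n ω)) z ^ 2 ∂μ.prod μ),
    Real.sqrt_nonneg _, fun f => ?_⟩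
  have h := Real.abs_le_sqrt (norm_integralOp_sq_le (sumSqKernel μ p (Z.Chat S p n ω))
    (memLp_sumSqKernel p (Z.measurable_Chat S p n ω) (Z.abs_Chat_le S p n ω)) f)
  rw [Real.sqrt_mul' _ (sq_nonneg _), Real.sqrt_sq (norm_nonneg _), abs_norm] at h
  refine (abs_real_inner_le_norm _ _).trans ?_
  rw [sq, ← mul_assoc]
  exact mul_le_mul_of_nonneg_right h (norm_nonneg _)

variable [IsProbabilityMeasure P]

theorem abs_inner_RhatOp_sub_ROp_le (p n : ℕ) (ω : Ω) (f : Lp ℝ 2 μ) :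
    |⟪Z.RhatOp S μ p n ω f - Z.ROp μ p f, f⟫_ℝ|
      ≤ √(4 * p * μ.real Set.univ ^ 2 * Z.covError S μ p n ω) * ‖f‖ ^ 2 := by
  have hK := integral_sumSqKernel_sub_sq_le (μ := μ) (Z.measurable_Chat S p n ω)
    (Z.abs_Chat_le S p n ω) Z.measurable_C Z.abs_C_le p
  rw [one_pow, mul_one] at hK
  have hn : ‖Z.RhatOp S μ p n ω f - Z.ROp μ p f‖ ^ 2
      ≤ 4 * p * μ.real Set.univ ^ 2 * Z.covError S μ p n ω * ‖f‖ ^ 2 := by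
    rw [RhatOp, ROp, integralOp_sub_apply]
    exact (norm_integralOp_sq_le _ _ f).trans (mul_le_mul_of_nonneg_right hK (sq_nonneg _))
  have h := Real.abs_le_sqrt hn
  rw [Real.sqrt_mul' _ (sq_nonneg _), Real.sqrt_sq (norm_nonneg _), abs_norm] at h
  refine (abs_real_inner_le_norm _ _).trans ?_
  rw [sq ‖f‖, ← mul_assoc]
  exact mul_le_mul_of_nonneg_right h (norm_nonneg _)

/-- The estimated dimension is correct as soon as the estimation error of the covariances is small
compared with the threshold, and the threshold is small compared with the eigenvalues of `R^μ`. -/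
theorem exists_forall_dHat_eq {p d : ℕ} (hR : RangeEquivalent (Z.ROp μ p) (Z.covOp μ))
    (hd : (Z.covOp μ).rank = d) :
    ∃ θ : ℝ, 0 < θ ∧ ∀ (n : ℕ) (a : ℝ) (ω : Ω), 0 < a → a < θ →
      4 * p * μ.real Set.univ ^ 2 * Z.covError S μ p n ω < a ^ 2 → Z.dHat S μ p n a ω = d := by
  obtain ⟨hfin, hrank⟩ := finrank_range_eq_of_rangeEquivalent hR hd
  have hsym : (Z.ROp μ p).IsSymmetric :=
    isSymmetric_integralOp_sumSqKernel Z.measurable_C Z.abs_C_le p _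
  have hpos : ∀ f, 0 ≤ ⟪Z.ROp μ p f, f⟫_ℝ := fun f =>
    inner_integralOp_sumSqKernel_nonneg Z.measurable_C Z.abs_C_le p _ f
  obtain ⟨θ, hθ, hθR⟩ := exists_pos_le_inner_of_mem_range hsym hpos
  -- Halving leaves room for both the threshold and the error: `δ < a < θ/2` gives `a + δ < θ`.
  refine ⟨θ / 2, half_pos hθ, fun n a ω ha haθ herr => ?_⟩
  have hδ := Z.abs_inner_RhatOp_sub_ROp_le S μ p n ω
  have hδa : √(4 * p * μ.real Set.univ ^ 2 * Z.covError S μ p n ω) < a :=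
    (Real.sqrt_lt' ha).2 herr
  have := Z.finiteDimensional_range_RhatOp S μ p n ω
  obtain ⟨M, hM0, hM⟩ := Z.exists_form_bound_RhatOp S μ p n ω
  have hset : {j : ℕ | a ≤ Z.thetaHat S μ p n ω j} = (Finset.range d : Set ℕ) := by
    ext j
    rw [Finset.coe_range, Set.mem_Iio]
    change a ≤ Z.thetaHat S μ p n ω j ↔ j < d
    constructor
    · intro hj
      by_contra! hdj
      exact absurd (hj.trans (eigenvalueSeq_le (Real.sqrt_nonneg _) hδ (hrank.le.trans hdj)))
        (not_le.2 hδa)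
    · intro hj
      exact le_eigenvalueSeq_of_form_lower_bound (Z.isSymmetric_RhatOp S μ p n ω) hM0 hM ha
        (by linarith) hδ hθR (hrank.symm ▸ hj)
  rw [dHat, hset, Set.encard_coe_eq_coe_finsetCard, Finset.card_range]

end Operators

end ConjugateProcess

end ConjugateProcesses

/-! ### Conclusion by Markov's inequality. -/

open ConjugateProcesses
theorem mainTheorem11 {Ω : Type*} [MeasurableSpace Ω] (P : Measure Ω) [IsProbabilityMeasure P]
    (Z : ConjugateProcess P) (hci : Z.CyclicIndependent)
    (S : SamplingScheme)
    (μ : Measure ℝ) [IsFiniteMeasure μ] (hμ : Z.IsDiffraction μ)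
    (p : ℕ) (hp : 1 ≤ p)
    (hmix : ∑' k : ℕ, ((k + 1 : ℕ) : ℝ≥0∞) *
      psiMixingCoeff P (Z.FhatLp S μ) (k + 1) ^ (1 / 2 : ℝ) < ∞)
    (hR : RangeEquivalent (Z.ROp μ p) (Z.covOp μ))
    (d : ℕ) (hd : (Z.covOp μ).rank = d)
    (a : ℕ → ℝ) (ha_pos : ∀ᶠ n in atTop, 0 < a n) (ha : Tendsto a atTop (𝓝 0))
    (ha' : Tendsto (fun n : ℕ => (n : ℝ) * a n ^ 2) atTop atTop) :
    Tendsto (fun n : ℕ => P {ω | Z.dHat S μ p n (a n) ω ≠ d}) atTop (𝓝 0) := by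
  obtain ⟨hfin, hsum⟩ := psiMixingCoeff_summable hmix
  obtain ⟨θ, hθ, hdHat⟩ := Z.exists_forall_dHat_eq S μ hR hd
  set M : ℝ := 4 * p * μ.real Set.univ ^ 2 with hM
  have hM0 : 0 ≤ M := by positivity
  set K : ℝ := M * (p * (μ.prod μ).real Set.univ * Z.mseConst S μ p) with hK
  have hlim : Tendsto (fun n : ℕ => ENNReal.ofReal (K / ((n : ℝ) * a n ^ 2))) atTop (𝓝 0) := by
    rw [← ENNReal.ofReal_zero]
    exact ENNReal.tendsto_ofReal (ha'.const_div_atTop K)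
  refine tendsto_of_tendsto_of_tendsto_of_le_of_le' tendsto_const_nhds hlim
    (Eventually.of_forall fun n => zero_le) ?_
  filter_upwards [ha_pos, ha.eventually (Iio_mem_nhds hθ), eventually_gt_atTop 0,
    eventually_ge_atTop (2 * p)] with n hn1 hn2 hn3 hn4
  -- Measurability of `d̂` is not needed: the failure set is only compared with a larger set by
  -- monotonicity of `P`.
  have hsub : {ω | Z.dHat S μ p n (a n) ω ≠ d} ⊆ {ω | a n ^ 2 ≤ M * Z.covError S μ p n ω} := by
    intro ω hω
    by_contra hcon
    exact hω (hdHat n (a n) ω hn1 hn2 (not_le.1 hcon))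
  have hmarkov := mul_meas_ge_le_integral_of_nonneg (μ := P)
    (Eventually.of_forall fun ω => mul_nonneg hM0 (Z.covError_nonneg S μ p n ω))
    ((Z.integrable_covError S (μ := μ) p n).const_mul M) (a n ^ 2)
  rw [integral_const_mul] at hmarkov
  have hmean := mul_le_mul_of_nonneg_left
    (Z.integral_covError_le S hci hμ hfin hsum hn3 hn4) hM0
  refine (measure_mono hsub).trans ?_
  rw [← ofReal_measureReal]
  refine ENNReal.ofReal_le_ofReal ?_
  have hn3' : (0 : ℝ) < n := by exact_mod_cast hn3
  rw [le_div_iff₀ (by positivity)]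
  have h1 := hmarkov.trans hmean
  rw [← mul_div_assoc, ← hK, le_div_iff₀ hn3'] at h1
  linarith
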